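/- For a finite simple graph $G$ on $m$ vertices, let $\lambda_1(G) \geq \lambda_2(G) \geq \dots \geq \lambda_m(G)$ be the eigenvalues of its adjacency matrix, counted with multiplicity; those with index $i \neq 1$ are called nontrivial. A $d$-regular graph $G$ is called Ramanujan if $|\lambda_i(G)| \leq 2\sqrt{d-1}$ for all $i \neq 1$. A random $n$-lift of $G$ is the random graph $H$ on the vertex set $\{1,\dots,n\} \times V(G)$ obtained by choosing for each edge $uv$ of $G$ (oriented arbitrarily), independently, a uniformly random permutation $\pi_{uv}$ of $\{1,\dots,n\}$, the edges of $H$ being all the pairs $\{(i,u),(\pi_{uv}(i),v)\}$ with $uv \in E(G)$ and $1 \leq i \leq n$. There is an absolute constant $C > 0$ such that the following holds. Let $d \geq 3$, let $G$ be a $d$-regular Ramanujan graph and, for each $n \geq 1$, let $H$ be a random $n$-lift of $G$. Then, as $n \to \infty$ with $G$ fixed, with probability $1 - O(n^{-100})$ every nontrivial eigenvalue of $H$ is at most $C \sqrt{d}\,\log_2 d$ in absolute value; that is, there is a constant $K$, which may depend on $G$, such that for every $n \geq 1$ this holds with probability at least $1 - K n^{-100}$. -/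

import Mathlib

namespace RandomLift

open Classical in
/-- The eigenvalues of (the adjacency matrix of) a finite graph, counted with multiplicity and
listed in decreasing order `λ₀ ≥ λ₁ ≥ …`. -/
noncomputable def adjEigenvalues {V : Type*} [Fintype V] (G : SimpleGraph V) :
    Fin (Fintype.card V) → ℝ :=
  Matrix.IsHermitian.eigenvalues₀ (A := G.adjMatrix ℝ)
    (by
      rw [Matrix.IsHermitian, Matrix.conjTranspose_eq_transpose_of_trivial]
      exact G.isSymm_adjMatrix)

/-- Every nontrivial eigenvalue of `G`, that is every eigenvalue except one occurrence of the
largest one, is at most `b` in absolute value. For a regular graph the exempted occurrence is the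
one that belongs to the constant vector. -/
def NontrivialEigenvaluesBoundedBy {V : Type*} [Fintype V] (G : SimpleGraph V) (b : ℝ) : Prop :=
  ∀ i : Fin (Fintype.card V), (i : ℕ) ≠ 0 → |adjEigenvalues G i| ≤ b

open Classical in
/-- `G` is a `d`-regular Ramanujan graph: it is `d`-regular and all its nontrivial eigenvalues are
at most `2 √(d - 1)` in absolute value. -/
def IsRamanujan {V : Type*} [Fintype V] (G : SimpleGraph V) (d : ℕ) : Prop :=
  G.IsRegularOfDegree d ∧ NontrivialEigenvaluesBoundedBy G (2 * √((d : ℝ) - 1))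

/-- The edges of `G`, each listed once, as the pair of its endpoints in increasing order. The order
on the vertices only serves to orient the edges. -/
abbrev OrientedEdge {V : Type*} [LinearOrder V] (G : SimpleGraph V) : Type _ :=
  {e : V × V // G.Adj e.1 e.2 ∧ e.1 < e.2}

/-- The choices that determine an `n`-lift of `G`: a bijection of `[n]` for each edge. -/
abbrev LiftData {V : Type*} [LinearOrder V] (G : SimpleGraph V) (n : ℕ) : Type _ :=
  OrientedEdge G → Equiv.Perm (Fin n)

/-- The `n`-lift of `G` on the vertices `[n] × V` given by the bijections `π`: for each edge `u v`
of `G` (with `u < v`) it has the edges `(i, u), (π_{uv} i, v)` for `i` in `[n]`, and no others. -/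
def lift {V : Type*} [LinearOrder V] {G : SimpleGraph V} {n : ℕ} (π : LiftData G n) :
    SimpleGraph (Fin n × V) where
  Adj x y :=
    (∃ h : G.Adj x.2 y.2 ∧ x.2 < y.2, π ⟨(x.2, y.2), h⟩ x.1 = y.1) ∨
      (∃ h : G.Adj y.2 x.2 ∧ y.2 < x.2, π ⟨(y.2, x.2), h⟩ y.1 = x.1)
  symm := ⟨fun _ _ h => h.symm⟩
  loopless := ⟨fun x h => by rcases h with ⟨h, -⟩ | ⟨h, -⟩ <;> exact lt_irrefl _ h.2⟩

/-- The probability that the random `n`-lift of `G` has the property `P`. The bijections attached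
to the edges are independent and uniform, i.e. their family is uniform on the finite set
`LiftData G n`, so this is the number of favourable families divided by the number of all. -/
noncomputable def liftProb {V : Type*} [Fintype V] [LinearOrder V] (G : SimpleGraph V) (n : ℕ)
    (P : SimpleGraph (Fin n × V) → Prop) : ℝ :=
  (Nat.card {π : LiftData G n // P (lift π)} : ℝ) / (Nat.card (LiftData G n) : ℝ)

end RandomLift

/-! The quadratic form of `lift π` at `f` is twice the centered form of the random matchings at `f`
plus `1/n` times the form of `G` at the fibre sums of `f` (`adjForm_lift_self`). If `f` is
orthogonal to the constants, so are its fibre sums, and since `G` is Ramanujan the second part is at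
most `2√(d-1) ‖f‖²`, by Cauchy-Schwarz on the fibres. What remains is to bound the norm of
`centeredForm` by `O(√d log d)`.

As in the converse of the expander mixing lemma of Bilu and Linial, such a bound follows from a
discrepancy bound `|X - μ| ≤ C (√(d |S| |T|) + |S| + |T|)`, where `X` is the number of matching
edges from `S` to `T` and `μ` its mean. A vector with natural entries is expanded in binary digits.
Two digit scales whose ratio is at most about `√d` are handled by the discrepancy, all others by the
trivial degree bound; the logarithm is the number of scales near a given one (`abs_sum_scales_le`).

Randomness enters only through a Chernoff bound for `X` (`sum_perm_pow_le`) and a union bound over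
all pairs of sets. Each pair is charged its entropy, the sum of `s (1 + log (n / s))` over its fibre
sizes `s`, which keeps the failure probability at `O(n⁻¹⁰⁰)` (`card_not_isConcentrated_le`).

The entropy can far exceed `|S| + |T|`, because fibres may be very sparse. They are therefore sorted
by the dyadic level `p` of `1 + log (n / s)`. At level `p` the entropy is about `2^p s`, but the
density `s / n` is at most `exp (1 - 2^p)`, and this doubly exponential gain pays for the entropy. A
pair of levels is either dominated by the entropy of the denser one, or has few expected edges
compared with its entropy, or is in the Gaussian range with room to spare. The three estimates
`deviation_dominated`, `deviation_heavy` and `deviation_light` sum to `IsMixing.discrepancy`. -/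

namespace RandomLift

open Finset

/-! ### Exponential moments for a uniform permutation -/

section Permutations

variable {α : Type*} [Fintype α] [DecidableEq α]

/-- The permutations that map `K` into `T`. -/
def permsInto (K T : Finset α) : Finset (Equiv.Perm α) :=
  univ.filter fun π => ∀ i ∈ K, π i ∈ T

/-- Composition with the transposition of `a` and `b` is a bijection between the two sets, as it
fixes `K` pointwise. -/
lemma card_permsInto_insert_eq (K T : Finset α) {a b : α} (ha : a ∉ K) (hb : b ∉ K) :
    (permsInto (insert a K) T).card = (permsInto (insert b K) T).card := by
  have key : ∀ π : Equiv.Perm α, ∀ i ∈ K, (π * Equiv.swap a b) i = π i := by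
    intro π i hi
    rw [Equiv.Perm.mul_apply, Equiv.swap_apply_of_ne_of_ne]
    · rintro rfl; exact ha hi
    · rintro rfl; exact hb hi
  refine Finset.card_bij (fun π _ => π * Equiv.swap a b) ?_ ?_ ?_
  · intro π hπ
    simp only [permsInto, mem_filter, mem_univ, true_and, mem_insert, forall_eq_or_imp] at hπ ⊢
    refine ⟨by simpa using hπ.1, fun i hi => ?_⟩
    rw [key π i hi]; exact hπ.2 i hi
  · intro π _ π' _ h
    exact mul_right_cancel h
  · intro π hπ
    refine ⟨π * Equiv.swap a b, ?_, by simp [mul_assoc]⟩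
    simp only [permsInto, mem_filter, mem_univ, true_and, mem_insert, forall_eq_or_imp] at hπ ⊢
    refine ⟨by simpa using hπ.1, fun i hi => ?_⟩
    rw [key π i hi]; exact hπ.2 i hi

/-- Double count the pairs of a permutation mapping `K` into `T` and a point `b` outside `K` sent
into `T`. Such a permutation has exactly `|T| - |K|` such points, and by symmetry every `b` is in
equally many pairs. -/
lemma card_permsInto_insert (K T : Finset α) {a : α} (ha : a ∉ K) :
    ((Fintype.card α : ℝ) - K.card) * (permsInto (insert a K) T).card =
      ((T.card : ℝ) - K.card) * (permsInto K T).card := by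
  have h1 : ∑ b ∈ Kᶜ, ((permsInto (insert b K) T).card : ℝ) =
      ((Fintype.card α : ℝ) - K.card) * (permsInto (insert a K) T).card := by
    rw [Finset.sum_congr rfl (fun b hb => by
      rw [card_permsInto_insert_eq K T (mem_compl.1 hb) ha]), sum_const, card_compl, nsmul_eq_mul,
      Nat.cast_sub (card_le_univ K)]
  have h2 : ∑ b ∈ Kᶜ, ((permsInto (insert b K) T).card : ℝ) =
      ∑ π ∈ permsInto K T, ((Kᶜ.filter fun b => π b ∈ T).card : ℝ) := by
    have e1 : ∀ b, permsInto (insert b K) T = (permsInto K T).filter fun π => π b ∈ T := by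
      intro b; ext π
      simp [permsInto, and_comm]
    simp only [e1, card_filter, Nat.cast_sum]
    exact sum_comm
  have h3 : ∀ π ∈ permsInto K T, ((Kᶜ.filter fun b => π b ∈ T).card : ℝ) =
      (T.card : ℝ) - K.card := by
    intro π hπ
    simp only [permsInto, mem_filter, mem_univ, true_and] at hπ
    have e2 : (univ.filter fun b => π b ∈ T).card = T.card := by
      rw [← Finset.card_map (s := T) π.symm.toEmbedding]
      congr 1
      ext b
      simp only [mem_filter, mem_univ, true_and, mem_map_equiv, Equiv.symm_symm]
    have e3 : (univ.filter fun b => π b ∈ T) = (Kᶜ.filter fun b => π b ∈ T) ∪ K := by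
      ext b
      simp only [mem_filter, mem_univ, true_and, mem_union, mem_compl]
      constructor
      · intro h; by_cases hb : b ∈ K
        · exact Or.inr hb
        · exact Or.inl ⟨hb, h⟩
      · rintro (h | h)
        · exact h.2
        · exact hπ b h
    have e4 : Disjoint (Kᶜ.filter fun b => π b ∈ T) K := by
      rw [Finset.disjoint_left]; intro b hb; exact mem_compl.1 (mem_filter.1 hb).1
    rw [e3, card_union_of_disjoint e4] at e2
    rw [← e2]; push_cast; ring
  rw [← h1, h2, sum_congr rfl h3, sum_const, nsmul_eq_mul, mul_comm]

/-- Sampling without replacement only helps: each new point contributes the ratio `(t - k) / (n -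
k)`, which is at most `t / n` because `t ≤ n`. -/
lemma card_permsInto_le (K T : Finset α) :
    ((permsInto K T).card : ℝ) ≤
      (Fintype.card (Equiv.Perm α) : ℝ) * ((T.card : ℝ) / Fintype.card α) ^ K.card := by
  induction K using Finset.induction_on with
  | empty => simp [permsInto]
  | insert a K ha ih =>
    have h := card_permsInto_insert K T ha
    have hlt : K.card < Fintype.card α := by
      rw [← card_univ]; exact card_lt_card ⟨subset_univ _, fun h => ha (h (mem_univ a))⟩
    have hlt' : (K.card : ℝ) < Fintype.card α := by exact_mod_cast hlt
    have hT : (T.card : ℝ) ≤ Fintype.card α := by exact_mod_cast card_le_univ T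
    have hn : (0 : ℝ) < Fintype.card α := lt_of_le_of_lt (Nat.cast_nonneg _) hlt'
    have step : ((permsInto (insert a K) T).card : ℝ) ≤
        (permsInto K T).card * ((T.card : ℝ) / Fintype.card α) := by
      rw [← mul_div_assoc, le_div_iff₀ hn]
      refine le_of_mul_le_mul_left ?_ (sub_pos.2 hlt')
      rw [← mul_assoc, h]
      have hk : (0 : ℝ) ≤ K.card := Nat.cast_nonneg _
      have hN : (0 : ℝ) ≤ (permsInto K T).card := Nat.cast_nonneg _
      nlinarith [mul_nonneg hN (mul_nonneg hk (sub_nonneg.2 hT))]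
    rw [card_insert_of_notMem ha, pow_succ, ← mul_assoc]
    exact step.trans (mul_le_mul_of_nonneg_right ih (by positivity))

/-- Expanding `w = 1 + (w - 1)` over the subsets `K` of `S` reduces the moment to
`card_permsInto_le`; the coefficients `(w - 1) ^ |K|` are nonnegative only for `w ≥ 1`. -/
lemma sum_perm_pow_le_of_one_le (S T : Finset α) {w : ℝ} (hw : 1 ≤ w) :
    ∑ π : Equiv.Perm α, w ^ (S.filter fun i => π i ∈ T).card ≤
      (Fintype.card (Equiv.Perm α) : ℝ) *
        (1 + (w - 1) * ((T.card : ℝ) / Fintype.card α)) ^ S.card := by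
  have h1 : ∀ π : Equiv.Perm α, w ^ (S.filter fun i => π i ∈ T).card =
      ∑ K ∈ S.powerset, if ∀ i ∈ K, π i ∈ T then (w - 1) ^ K.card else 0 := by
    intro π
    rw [← prod_const, prod_filter]
    have : ∀ i ∈ S, (if π i ∈ T then w else 1) = 1 + (if π i ∈ T then w - 1 else 0) := by
      intro i _; split_ifs <;> ring
    rw [prod_congr rfl this, prod_one_add]
    refine sum_congr rfl fun K _ => ?_
    rw [prod_ite_zero, prod_const]
    congr
  simp only [h1]
  rw [sum_comm]
  have h2 : ∀ K ∈ S.powerset,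
      (∑ π : Equiv.Perm α, if ∀ i ∈ K, π i ∈ T then (w - 1) ^ K.card else 0) ≤
      (Fintype.card (Equiv.Perm α) : ℝ) *
        ∏ _i ∈ K, ((w - 1) * ((T.card : ℝ) / Fintype.card α)) := by
    intro K _
    rw [← sum_filter, sum_const, nsmul_eq_mul, prod_const, mul_pow, mul_left_comm]
    have := card_permsInto_le K T
    rw [permsInto] at this
    rw [mul_comm]
    exact mul_le_mul_of_nonneg_left this (pow_nonneg (by linarith) _)
  refine (sum_le_sum h2).trans ?_
  rw [← mul_sum, ← prod_one_add, prod_const]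

lemma sum_perm_pow_le (S T : Finset α) {w : ℝ} (hw : 0 < w) :
    ∑ π : Equiv.Perm α, w ^ (S.filter fun i => π i ∈ T).card ≤
      (Fintype.card (Equiv.Perm α) : ℝ) *
        Real.exp ((w - 1) * ((S.card : ℝ) * T.card / Fintype.card α)) := by
  have hT : (T.card : ℝ) / Fintype.card α ≤ 1 :=
    div_le_one_of_le₀ (by exact_mod_cast card_le_univ T) (Nat.cast_nonneg _)
  have hT0 : 0 ≤ (T.card : ℝ) / Fintype.card α := by positivity
  have hexp : 0 ≤ 1 + (w - 1) * ((T.card : ℝ) / Fintype.card α) →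
      (1 + (w - 1) * ((T.card : ℝ) / Fintype.card α)) ^ S.card ≤
      Real.exp ((w - 1) * ((S.card : ℝ) * T.card / Fintype.card α)) := by
    intro h0
    have : (w - 1) * ((S.card : ℝ) * T.card / Fintype.card α) =
      S.card * ((w - 1) * ((T.card : ℝ) / Fintype.card α)) := by ring
    rw [this, Real.exp_nat_mul]
    exact pow_le_pow_left₀ h0 (by linarith [Real.add_one_le_exp ((w - 1) * ((T.card : ℝ) / Fintype.card α))]) _
  rcases le_total 1 w with h1 | h1
  · refine (sum_perm_pow_le_of_one_le S T h1).trans ?_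
    refine mul_le_mul_of_nonneg_left (hexp ?_) (Nat.cast_nonneg _)
    have := mul_nonneg (sub_nonneg.2 h1) hT0
    linarith
  · rcases S.eq_empty_or_nonempty with rfl | hS
    · simp
    have hn : (0 : ℝ) < Fintype.card α := by
      obtain ⟨a, -⟩ := hS
      exact_mod_cast Fintype.card_pos_iff.2 ⟨a⟩
    -- For `w ≤ 1` count the points sent outside `T` instead, with weight `w⁻¹ ≥ 1`. After
    -- multiplication by `w ^ |S|` the base is exactly the one for `T` and `w`.
    have h2 := sum_perm_pow_le_of_one_le S Tᶜ (one_le_inv_iff₀.2 ⟨hw, h1⟩)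
    have h3 : ∀ π : Equiv.Perm α, w ^ (S.filter fun i => π i ∈ T).card =
        w ^ S.card * w⁻¹ ^ (S.filter fun i => π i ∈ Tᶜ).card := by
      intro π
      have e := card_filter_add_card_filter_not (s := S) (p := fun i => π i ∈ T)
      simp only [mem_compl]
      rw [← e, pow_add, mul_assoc, ← mul_pow, mul_inv_cancel₀ hw.ne', one_pow, mul_one]
    simp only [h3]
    rw [← mul_sum]
    refine (mul_le_mul_of_nonneg_left h2 (by positivity)).trans ?_
    rw [mul_left_comm, ← mul_pow]
    refine mul_le_mul_of_nonneg_left ?_ (Nat.cast_nonneg _)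
    have e5 : w * (1 + (w⁻¹ - 1) * ((Tᶜ.card : ℝ) / Fintype.card α)) =
        1 + (w - 1) * ((T.card : ℝ) / Fintype.card α) := by
      rw [card_compl, Nat.cast_sub (card_le_univ T)]
      field_simp
      ring
    rw [e5]
    refine hexp ?_
    nlinarith

end Permutations

/-! ### Entropy of subsets -/

/-- The entropy bound `s (1 + log (n / s))` for the logarithm of the number of `s`-subsets of an
`n`-set. -/
noncomputable def subsetEntropy (n : ℕ) (s : ℝ) : ℝ := s * (1 + Real.log (n / s))

lemma subsetEntropy_zero (n : ℕ) : subsetEntropy n 0 = 0 := by simp [subsetEntropy]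

lemma subsetEntropy_nonneg {n : ℕ} {s : ℝ} (h0 : 0 ≤ s) (hs : s ≤ n) : 0 ≤ subsetEntropy n s := by
  rcases h0.eq_or_lt with rfl | h0
  · rw [subsetEntropy_zero]
  · have : 0 ≤ Real.log (n / s) := Real.log_nonneg ((one_le_div h0).2 hs)
    unfold subsetEntropy
    positivity

/-- Among sizes from `1` to `n` the entropy is least at size `1`. Hence the entropy of any nonempty
set pays for powers of `n`. -/
lemma one_add_log_le_subsetEntropy {n k : ℕ} (hk : 1 ≤ k) (hkn : k ≤ n) :
    1 + Real.log n ≤ subsetEntropy n k := by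
  have hk0 : (0 : ℝ) < k := by exact_mod_cast hk
  have hk1 : (1 : ℝ) ≤ k := by exact_mod_cast hk
  have hn0 : (0 : ℝ) < n := lt_of_lt_of_le hk0 (by exact_mod_cast hkn)
  have h1 : Real.log k ≤ k - 1 := Real.log_le_sub_one_of_pos hk0
  have h2 : Real.log k ≤ Real.log n := Real.log_le_log hk0 (by exact_mod_cast hkn)
  rw [subsetEntropy, Real.log_div hn0.ne' hk0.ne']
  nlinarith [mul_le_mul_of_nonneg_left h2 (sub_nonneg.2 hk1)]

lemma choose_le_exp_subsetEntropy {n k : ℕ} (hkn : k ≤ n) :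
    (n.choose k : ℝ) ≤ Real.exp (subsetEntropy n k) := by
  rcases Nat.eq_zero_or_pos k with rfl | hk
  · simp [subsetEntropy]
  have hk0 : (0 : ℝ) < k := by exact_mod_cast hk
  have hn0 : (0 : ℝ) < n := lt_of_lt_of_le hk0 (by exact_mod_cast hkn)
  have h1 : (n.choose k : ℝ) ≤ (n : ℝ) ^ k / (k.factorial : ℝ) := Nat.choose_le_pow_div k n
  have h2 : (k : ℝ) ^ k / (k.factorial : ℝ) ≤ Real.exp k :=
    Real.pow_div_factorial_le_exp (k : ℝ) hk0.le k
  have h3 : Real.exp (subsetEntropy n k) = Real.exp k * ((n : ℝ) / k) ^ k := by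
    rw [subsetEntropy, mul_add, mul_one, Real.exp_add, Real.exp_nat_mul,
      Real.exp_log (by positivity)]
  rw [h3]
  refine h1.trans ?_
  have h4 : (n : ℝ) ^ k / (k.factorial : ℝ) =
      ((k : ℝ) ^ k / (k.factorial : ℝ)) * ((n : ℝ) / k) ^ k := by
    rw [div_pow]; field_simp
  rw [h4]
  exact mul_le_mul_of_nonneg_right h2 (by positivity)

/-- One copy of the entropy cancels the number of subsets of the given size; the other is at least
`log n`, so each of the `n` nonzero sizes contributes at most `1 / n`. The empty set contributes
`1`. -/
lemma sum_exp_neg_subsetEntropy_le (n : ℕ) :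
    ∑ A : Finset (Fin n), Real.exp (-(2 * subsetEntropy n A.card)) ≤ 2 := by
  rcases Nat.eq_zero_or_pos n with rfl | hn
  · have : (univ : Finset (Finset (Fin 0))) = {∅} := by decide
    rw [this]; simp [subsetEntropy_zero]
  have hn0 : (0 : ℝ) < n := by exact_mod_cast hn
  rw [← powerset_univ, sum_powerset_apply_card (fun k : ℕ => Real.exp (-(2 * subsetEntropy n k))),
    card_univ, Fintype.card_fin, sum_range_succ']
  have h1 : ∀ k ∈ range n, (n.choose (k + 1)) • Real.exp (-(2 * subsetEntropy n ((k + 1 : ℕ) : ℝ)))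
      ≤ 1 / n := by
    intro k hk
    have hk' : k + 1 ≤ n := by have := mem_range.1 hk; omega
    have h2 := choose_le_exp_subsetEntropy hk'
    have h3 := one_add_log_le_subsetEntropy (Nat.le_add_left 1 k) hk'
    rw [nsmul_eq_mul]
    calc _ ≤ Real.exp (subsetEntropy n ((k + 1 : ℕ) : ℝ)) *
          Real.exp (-(2 * subsetEntropy n ((k + 1 : ℕ) : ℝ))) :=
          mul_le_mul_of_nonneg_right h2 (Real.exp_pos _).le
      _ = Real.exp (-subsetEntropy n ((k + 1 : ℕ) : ℝ)) := by rw [← Real.exp_add]; ring_nf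
      _ ≤ Real.exp (-Real.log n) := Real.exp_le_exp.2 (by linarith)
      _ = 1 / n := by rw [Real.exp_neg, Real.exp_log hn0, one_div]
  have h4 := sum_le_sum h1
  rw [sum_const, card_range, nsmul_eq_mul, mul_one_div_cancel hn0.ne'] at h4
  have h5 : (n.choose 0) • Real.exp (-(2 * subsetEntropy n ((0 : ℕ) : ℝ))) = 1 := by
    simp [subsetEntropy_zero]
  rw [h5]
  linarith

/-! ### Chernoff bounds for crossings and the union bound -/

section Crossings

variable {V E : Type*} {n : ℕ}

/-- The number of matching edges over `e` from `S` to `T`. -/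
def crossings (src tgt : E → V) (π : E → Equiv.Perm (Fin n)) (S T : V → Finset (Fin n)) (e : E) :
    ℝ :=
  (((S (src e)).filter fun i => π e i ∈ T (tgt e)).card : ℝ)

/-- The expected number of matching edges over `e` from `S` to `T`. -/
noncomputable def meanCrossings (src tgt : E → V) (S T : V → Finset (Fin n)) (e : E) : ℝ :=
  ((S (src e)).card : ℝ) * (T (tgt e)).card / n

variable (src tgt : E → V)

lemma meanCrossings_nonneg (S T : V → Finset (Fin n)) (e : E) :
    0 ≤ meanCrossings src tgt S T e := by
  unfold meanCrossings; positivity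

lemma crossings_nonneg (π : E → Equiv.Perm (Fin n)) (S T : V → Finset (Fin n)) (e : E) :
    0 ≤ crossings src tgt π S T e := Nat.cast_nonneg _

variable [Fintype E]

/-- The permutations of different edges are independent, so the moment factors into those of single
permutations. -/
lemma sum_exp_crossings_le [DecidableEq E] (S T : V → Finset (Fin n)) (θ : ℝ) :
    ∑ π : E → Equiv.Perm (Fin n), Real.exp (θ * ∑ e, crossings src tgt π S T e) ≤
      (Fintype.card (E → Equiv.Perm (Fin n)) : ℝ) *
        Real.exp ((Real.exp θ - 1) * ∑ e, meanCrossings src tgt S T e) := by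
  have h1 : ∀ π : E → Equiv.Perm (Fin n), Real.exp (θ * ∑ e, crossings src tgt π S T e) =
      ∏ e, Real.exp θ ^ ((S (src e)).filter fun i => π e i ∈ T (tgt e)).card := by
    intro π
    rw [mul_sum, Real.exp_sum]
    refine prod_congr rfl fun e _ => ?_
    rw [crossings, mul_comm, Real.exp_nat_mul]
  simp only [h1]
  rw [← Fintype.prod_sum (fun (e : E) (σ : Equiv.Perm (Fin n)) =>
    Real.exp θ ^ ((S (src e)).filter fun i => σ i ∈ T (tgt e)).card)]
  rw [mul_sum, Real.exp_sum, Fintype.card_fun, Nat.cast_pow, ← card_univ (α := E), ← prod_const,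
    ← prod_mul_distrib]
  refine prod_le_prod (fun e _ => sum_nonneg fun _ _ => by positivity) fun e _ => ?_
  have := sum_perm_pow_le (S (src e)) (T (tgt e)) (Real.exp_pos θ)
  rwa [Fintype.card_fin] at this

-- Markov's inequality for the exponential moment. The sign of `θ` is free, so both tails are
-- covered.
open Classical in
lemma card_tail_le (S T : V → Finset (Fin n)) (θ h : ℝ) :
    (((univ : Finset (E → Equiv.Perm (Fin n))).filter fun π =>
      ¬ θ * ∑ e, crossings src tgt π S T e ≤
        h + (Real.exp θ - 1) * ∑ e, meanCrossings src tgt S T e).card : ℝ) ≤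
      (Fintype.card (E → Equiv.Perm (Fin n)) : ℝ) * Real.exp (-h) := by
  set μ := ∑ e, meanCrossings src tgt S T e
  set B := (univ : Finset (E → Equiv.Perm (Fin n))).filter fun π =>
      ¬ θ * ∑ e, crossings src tgt π S T e ≤ h + (Real.exp θ - 1) * μ
  have h1 : (B.card : ℝ) * Real.exp (h + (Real.exp θ - 1) * μ) ≤
      ∑ π : E → Equiv.Perm (Fin n), Real.exp (θ * ∑ e, crossings src tgt π S T e) := by
    rw [← nsmul_eq_mul, ← sum_const]
    refine (sum_le_sum fun π hπ => ?_).trans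
      (sum_le_sum_of_subset_of_nonneg (subset_univ B) fun _ _ _ => (Real.exp_pos _).le)
    exact Real.exp_le_exp.2 (not_le.1 (mem_filter.1 hπ).2).le
  have h2 := h1.trans (sum_exp_crossings_le src tgt S T θ)
  rw [Real.exp_add, ← mul_assoc] at h2
  have h3 := le_of_mul_le_mul_right h2 (Real.exp_pos _)
  rw [Real.exp_neg, ← div_eq_mul_inv, le_div_iff₀ (Real.exp_pos _)]
  exact h3

/-- If the mean vanishes, every edge has an empty fibre at one end. This settles the case in which
the divisions by the mean in `tilts` are meaningless. -/
lemma crossings_eq_zero {src tgt : E → V} {π : E → Equiv.Perm (Fin n)} {S T : V → Finset (Fin n)} (hn : 1 ≤ n)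
    (h : ∑ e, meanCrossings src tgt S T e = 0) : ∑ e, crossings src tgt π S T e = 0 := by
  have hn0 : (n : ℝ) ≠ 0 := by positivity
  rw [sum_eq_zero_iff_of_nonneg fun e _ => meanCrossings_nonneg src tgt S T e] at h
  refine sum_eq_zero fun e he => ?_
  have := h e he
  rw [meanCrossings, div_eq_zero_iff, mul_eq_zero] at this
  rcases this with (h | h) | h
  · have : S (src e) = ∅ := card_eq_zero.1 (by exact_mod_cast h)
    simp [crossings, this]
  · have : T (tgt e) = ∅ := card_eq_zero.1 (by exact_mod_cast h)
    simp [crossings, this]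
  · exact absurd h hn0

variable [Fintype V]

/-- The entropy of a subset of `[n] × V` that is given by its fibres. -/
noncomputable def entropy (S : V → Finset (Fin n)) : ℝ := ∑ u, subsetEntropy n (S u).card

lemma entropy_nonneg (S : V → Finset (Fin n)) : 0 ≤ entropy S :=
  sum_nonneg fun u _ => subsetEntropy_nonneg (Nat.cast_nonneg _)
    (by exact_mod_cast (card_le_univ (S u)).trans_eq (Fintype.card_fin n))

lemma entropy_empty : entropy (fun _ : V => (∅ : Finset (Fin n))) = 0 := by
  simp [entropy, subsetEntropy_zero]

lemma log_le_entropy {S : V → Finset (Fin n)} (hS : S ≠ fun _ => ∅) :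
    Real.log n ≤ entropy S := by
  obtain ⟨u, hu⟩ : ∃ u, S u ≠ ∅ := by
    by_contra! h; exact hS (funext h)
  have h1 : 1 ≤ (S u).card := card_pos.2 (nonempty_iff_ne_empty.2 hu)
  have h2 : (S u).card ≤ n := (card_le_univ (S u)).trans_eq (Fintype.card_fin n)
  have h3 := one_add_log_le_subsetEntropy h1 h2
  have h4 : subsetEntropy n (S u).card ≤ entropy S :=
    single_le_sum (f := fun u => subsetEntropy n (S u).card) (fun u _ =>
      subsetEntropy_nonneg (Nat.cast_nonneg _)
        (by exact_mod_cast (card_le_univ (S u)).trans_eq (Fintype.card_fin n))) (mem_univ u)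
  linarith

lemma sum_exp_neg_entropy_le [DecidableEq V] :
    ∑ S : V → Finset (Fin n), Real.exp (-(2 * entropy S)) ≤ 2 ^ Fintype.card V := by
  have h1 : ∀ S : V → Finset (Fin n), Real.exp (-(2 * entropy S)) =
      ∏ u, Real.exp (-(2 * subsetEntropy n (S u).card)) := by
    intro S
    rw [← Real.exp_sum, entropy, mul_sum, sum_neg_distrib]
  simp only [h1]
  rw [← Fintype.prod_sum (fun (_ : V) (A : Finset (Fin n)) =>
    Real.exp (-(2 * subsetEntropy n A.card)))]
  rw [prod_const, card_univ]
  exact pow_le_pow_left₀ (sum_nonneg fun _ _ => (Real.exp_pos _).le)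
    (sum_exp_neg_subsetEntropy_le n) _

/-- The parameters at which the exponential moment of the number of crossings is used. -/
noncomputable def tilts (S T : V → Finset (Fin n)) : Fin 3 → ℝ :=
  -- The first two are the optimal Gaussian tilt for the upper and the lower tail, capped at `1` so
  -- that `exp θ - 1 - θ` stays below `θ²`. The third is for upper deviations far beyond the mean.
  ![min 1 √(102 * (entropy S + entropy T) / ∑ e, meanCrossings src tgt S T e),
    -min 1 √(102 * (entropy S + entropy T) / ∑ e, meanCrossings src tgt S T e),
    Real.log (8 * (entropy S + entropy T) / ∑ e, meanCrossings src tgt S T e)]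

/-- All numbers of crossings satisfy the Chernoff bounds at a level that pays for the entropy of the
two sets. -/
def IsConcentrated (π : E → Equiv.Perm (Fin n)) : Prop :=
  ∀ S T : V → Finset (Fin n), ∀ k : Fin 3,
    tilts src tgt S T k * ∑ e, crossings src tgt π S T e ≤
      102 * (entropy S + entropy T) +
        (Real.exp (tilts src tgt S T k) - 1) * ∑ e, meanCrossings src tgt S T e

-- The level `102 = 100 + 2` times the entropy splits: two copies make the sum over pairs of sets
-- converge, and the other hundred give `n⁻¹⁰⁰`, since some set is nonempty. For two empty sets the
-- inequalities hold with certainty. The factors are `3` for the tilts and `2 ^ |V|` for each of the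
-- two sets.
open Classical in
lemma card_not_isConcentrated_le (hn : 1 ≤ n) :
    (((univ : Finset (E → Equiv.Perm (Fin n))).filter fun π =>
      ¬ IsConcentrated src tgt π).card : ℝ) ≤
      (3 * 4 ^ Fintype.card V) / (n : ℝ) ^ 100 *
        (Fintype.card (E → Equiv.Perm (Fin n)) : ℝ) := by
  have hn0 : (0 : ℝ) < n := by exact_mod_cast hn
  set N := (Fintype.card (E → Equiv.Perm (Fin n)) : ℝ)
  have hN : 0 ≤ N := Nat.cast_nonneg _
  let B : (V → Finset (Fin n)) × (V → Finset (Fin n)) → Fin 3 →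
      Finset (E → Equiv.Perm (Fin n)) := fun P k =>
    univ.filter fun π => ¬ tilts src tgt P.1 P.2 k * ∑ e, crossings src tgt π P.1 P.2 e ≤
      102 * (entropy P.1 + entropy P.2) +
        (Real.exp (tilts src tgt P.1 P.2 k) - 1) * ∑ e, meanCrossings src tgt P.1 P.2 e
  have hB : ∀ P k, ((B P k).card : ℝ) ≤ N * (Real.exp (-(2 * entropy P.1)) *
      Real.exp (-(2 * entropy P.2)) / (n : ℝ) ^ 100) := by
    intro P k
    by_cases hP : P.1 = (fun _ => ∅) ∧ P.2 = fun _ => ∅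
    · have : B P k = ∅ := by
        refine filter_eq_empty_iff.2 fun π _ => ?_
        rw [not_not, hP.1, hP.2]
        simp [entropy_empty, crossings, meanCrossings]
      rw [this, card_empty, Nat.cast_zero]
      positivity
    · have h1 : Real.log n ≤ entropy P.1 + entropy P.2 := by
        rw [not_and_or] at hP
        rcases hP with h | h
        · linarith [log_le_entropy h, entropy_nonneg P.2]
        · linarith [log_le_entropy h, entropy_nonneg P.1]
      refine (card_tail_le src tgt P.1 P.2 _ _).trans (mul_le_mul_of_nonneg_left ?_ hN)
      rw [le_div_iff₀ (by positivity), ← Real.exp_log hn0, ← Real.exp_nat_mul, ← Real.exp_add,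
        ← Real.exp_add, Real.exp_le_exp]
      push_cast
      linarith
  have hsub : (univ.filter fun π : E → Equiv.Perm (Fin n) => ¬ IsConcentrated src tgt π) ⊆
      univ.biUnion fun P => univ.biUnion fun k => B P k := by
    intro π hπ
    have := (mem_filter.1 hπ).2
    unfold IsConcentrated at this
    push Not at this
    obtain ⟨S, T, k, h⟩ := this
    simp only [mem_biUnion, mem_univ, true_and]
    exact ⟨(S, T), k, mem_filter.2 ⟨mem_univ _, not_le.2 h⟩⟩
  calc (((univ : Finset (E → Equiv.Perm (Fin n))).filter fun π =>
      ¬ IsConcentrated src tgt π).card : ℝ)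
      ≤ ∑ P, ∑ k, ((B P k).card : ℝ) := by
        have h1 := (card_le_card hsub).trans (card_biUnion_le.trans
          (sum_le_sum fun P _ => card_biUnion_le))
        exact_mod_cast h1
    _ ≤ ∑ P : (V → Finset (Fin n)) × (V → Finset (Fin n)), ∑ _k : Fin 3,
          N * (Real.exp (-(2 * entropy P.1)) * Real.exp (-(2 * entropy P.2)) / (n : ℝ) ^ 100) :=
        sum_le_sum fun P _ => sum_le_sum fun k _ => hB P k
    _ = 3 / (n : ℝ) ^ 100 * N * ((∑ S : V → Finset (Fin n), Real.exp (-(2 * entropy S))) *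
          ∑ S : V → Finset (Fin n), Real.exp (-(2 * entropy S))) := by
        rw [sum_mul_sum, mul_sum, Fintype.sum_prod_type]
        refine sum_congr rfl fun S _ => ?_
        rw [mul_sum]
        refine sum_congr rfl fun T _ => ?_
        rw [sum_const, card_univ, Fintype.card_fin, nsmul_eq_mul]
        push_cast
        ring
    _ ≤ 3 / (n : ℝ) ^ 100 * N * (2 ^ Fintype.card V * 2 ^ Fintype.card V) := by
        refine mul_le_mul_of_nonneg_left ?_ (by positivity)
        have h0 : 0 ≤ ∑ S : V → Finset (Fin n), Real.exp (-(2 * entropy S)) :=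
          sum_nonneg fun _ _ => (Real.exp_pos _).le
        exact mul_le_mul sum_exp_neg_entropy_le sum_exp_neg_entropy_le h0 (by positivity)
    _ = _ := by
        rw [← mul_pow]; norm_num; ring

variable {src tgt}

lemma IsConcentrated.abs_sub_le {π : E → Equiv.Perm (Fin n)} (hn : 1 ≤ n)
    (hπ : IsConcentrated src tgt π) (S T : V → Finset (Fin n)) :
    |∑ e, crossings src tgt π S T e - ∑ e, meanCrossings src tgt S T e| ≤
      2 * max √(102 * (entropy S + entropy T) * ∑ e, meanCrossings src tgt S T e)
        (102 * (entropy S + entropy T)) := by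
  have h1 := hπ S T 0
  have h2 := hπ S T 1
  have hz := crossings_eq_zero (src := src) (tgt := tgt) (π := π) (S := S) (T := T) hn
  simp only [tilts, Matrix.cons_val_zero, Matrix.cons_val_one] at h1 h2
  set μ := ∑ e, meanCrossings src tgt S T e
  set X := ∑ e, crossings src tgt π S T e
  set h := 102 * (entropy S + entropy T)
  have hh : 0 ≤ h := by
    have := entropy_nonneg S; have := entropy_nonneg T; positivity
  have hμ : 0 ≤ μ := sum_nonneg fun e _ => meanCrossings_nonneg src tgt S T e
  rcases hμ.eq_or_lt with h0 | hμ
  · rw [hz h0.symm, ← h0]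
    simp [hh]
  -- Zero entropy forces empty fibres and hence zero mean, because a nonempty fibre has entropy at
  -- least `1`.
  rcases hh.eq_or_lt with h0 | hh
  · rw [← h0] at h1 h2 ⊢
    have hS : entropy S = 0 := by
      have := entropy_nonneg S; have := entropy_nonneg T; simp only [h] at h0; linarith
    have hμ0 : μ = 0 := by
      by_contra hne
      obtain ⟨e, -, he⟩ : ∃ e ∈ univ, meanCrossings src tgt S T e ≠ 0 := exists_ne_zero_of_sum_ne_zero hne
      have hcard : 1 ≤ (S (src e)).card := by
        by_contra hlt
        have : (S (src e)).card = 0 := by omega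
        simp [meanCrossings, this] at he
      have hle : (S (src e)).card ≤ n := (card_le_univ (S (src e))).trans_eq (Fintype.card_fin n)
      have h3 := one_add_log_le_subsetEntropy hcard hle
      have h4 : subsetEntropy n (S (src e)).card ≤ entropy S :=
        single_le_sum (f := fun u => subsetEntropy n (S u).card) (fun u _ =>
          subsetEntropy_nonneg (Nat.cast_nonneg _)
            (by exact_mod_cast (card_le_univ (S u)).trans_eq (Fintype.card_fin n)))
          (mem_univ (src e))
      have : 0 ≤ Real.log n := Real.log_natCast_nonneg n
      linarith
    exact absurd hμ0 hμ.ne'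
  set θ := min 1 √(h / μ)
  have hθ0 : 0 < θ := lt_min one_pos (Real.sqrt_pos.2 (div_pos hh hμ))
  have hθ1 : θ ≤ 1 := min_le_left _ _
  have e1 := abs_le.1 (Real.abs_exp_sub_one_sub_id_le (x := θ) (by rw [abs_of_pos hθ0]; exact hθ1))
  have e2 := abs_le.1 (Real.abs_exp_sub_one_sub_id_le (x := -θ)
    (by rw [abs_neg, abs_of_pos hθ0]; exact hθ1))
  have k1 : θ * (X - μ) ≤ h + θ ^ 2 * μ := by nlinarith [e1.2]
  have k2 : θ * (μ - X) ≤ h + θ ^ 2 * μ := by nlinarith [e2.2]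
  -- If `h ≤ μ`, then `θ = √(h / μ)` and both summands on the left equal `θ √(h μ)`; otherwise `θ =
  -- 1` and `μ ≤ h`.
  have k3 : h + θ ^ 2 * μ ≤ θ * (2 * max √(h * μ) h) := by
    rcases le_total h μ with hle | hle
    · have hs : √(h / μ) ≤ 1 := Real.sqrt_le_one.2 ((div_le_one hμ).2 hle)
      have hθ : θ = √(h / μ) := min_eq_right hs
      have q1 : θ ^ 2 * μ = h := by rw [hθ, Real.sq_sqrt (by positivity)]; field_simp
      have q2 : θ * √(h * μ) = h := by
        rw [hθ, ← Real.sqrt_mul (by positivity)]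
        rw [show h / μ * (h * μ) = h ^ 2 by field_simp, Real.sqrt_sq hh.le]
      have := mul_le_mul_of_nonneg_left (le_max_left √(h * μ) h) hθ0.le
      linarith
    · have hθ : θ = 1 := min_eq_left (by rw [Real.one_le_sqrt]; exact (one_le_div hμ).2 hle)
      rw [hθ]
      have := le_max_right √(h * μ) h
      linarith
  rw [abs_sub_le_iff]
  exact ⟨le_of_mul_le_mul_left (k1.trans k3) hθ0, le_of_mul_le_mul_left (k2.trans k3) hθ0⟩

/-- With `H` the total entropy and `μ` the mean, the third tilt is `log (8 H / μ)`. It makes the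
right side of the Chernoff bound at most `102 H + 8 H`, and the hypothesis says that `L` does not
exceed this tilt. -/
lemma IsConcentrated.mul_le {π : E → Equiv.Perm (Fin n)} (hn : 1 ≤ n)
    (hπ : IsConcentrated src tgt π) (S T : V → Finset (Fin n)) {L : ℝ}
    (h : Real.exp L * ∑ e, meanCrossings src tgt S T e ≤ 8 * (entropy S + entropy T)) :
    L * ∑ e, crossings src tgt π S T e ≤ 110 * (entropy S + entropy T) := by
  have h1 := hπ S T 2
  have hz := crossings_eq_zero (src := src) (tgt := tgt) (π := π) (S := S) (T := T) hn
  have hX : 0 ≤ ∑ e, crossings src tgt π S T e :=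
    sum_nonneg fun e _ => crossings_nonneg src tgt π S T e
  have hμ : 0 ≤ ∑ e, meanCrossings src tgt S T e :=
    sum_nonneg fun e _ => meanCrossings_nonneg src tgt S T e
  have hH : 0 ≤ entropy S + entropy T := add_nonneg (entropy_nonneg S) (entropy_nonneg T)
  simp only [tilts, Matrix.cons_val] at h1
  set μ := ∑ e, meanCrossings src tgt S T e
  set X := ∑ e, crossings src tgt π S T e
  set H := entropy S + entropy T
  rcases hμ.eq_or_lt with h0 | hμ
  · rw [hz h0.symm]; linarith
  have hpos : 0 < 8 * H / μ := by
    refine div_pos (lt_of_lt_of_le ?_ h) hμ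
    positivity
  have hle : L ≤ Real.log (8 * H / μ) := by
    rw [Real.le_log_iff_exp_le hpos, le_div_iff₀ hμ]; exact h
  rw [Real.exp_log hpos, sub_mul, div_mul_cancel₀ _ hμ.ne'] at h1
  have := mul_le_mul_of_nonneg_right hle hX
  linarith

end Crossings

/-! ### Dyadic levels of sparsity -/

/-- The dyadic scale of the logarithmic sparsity `1 + log (n / x)` of an `x`-subset of an
`n`-set. -/
noncomputable def sparsityLevel (n : ℕ) (x : ℝ) : ℕ := Nat.log 2 ⌊1 + Real.log (n / x)⌋₊

section Levels

variable {n : ℕ} {x : ℝ}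

lemma one_le_one_add_log (h0 : 0 ≤ x) (hx : x ≤ n) : 1 ≤ 1 + Real.log (n / x) := by
  -- By the conventions `n / 0 = 0` and `log 0 = 0` an empty fibre gets level `0`, where it
  -- contributes nothing.
  rcases h0.eq_or_lt with rfl | h0
  · simp
  · have : 0 ≤ Real.log (n / x) := Real.log_nonneg ((one_le_div h0).2 hx)
    linarith

lemma two_pow_sparsityLevel_le (h0 : 0 ≤ x) (hx : x ≤ n) :
    (2 : ℝ) ^ sparsityLevel n x ≤ 1 + Real.log (n / x) := by
  have h1 := one_le_one_add_log h0 hx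
  have h2 : 1 ≤ ⌊1 + Real.log (n / x)⌋₊ := Nat.one_le_floor_iff _ |>.2 h1
  have h3 : 2 ^ sparsityLevel n x ≤ ⌊1 + Real.log (n / x)⌋₊ := Nat.pow_log_le_self 2 (by omega)
  calc (2 : ℝ) ^ sparsityLevel n x = ((2 ^ sparsityLevel n x : ℕ) : ℝ) := by push_cast; rfl
    _ ≤ (⌊1 + Real.log (n / x)⌋₊ : ℝ) := by exact_mod_cast h3
    _ ≤ _ := Nat.floor_le (by linarith)

lemma one_add_log_le_two_pow : 1 + Real.log (n / x) ≤ 2 * (2 : ℝ) ^ sparsityLevel n x := by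
  have h3 : ⌊1 + Real.log (n / x)⌋₊ + 1 ≤ 2 ^ (sparsityLevel n x + 1) :=
    Nat.lt_pow_succ_log_self one_lt_two _
  have h4 := (Nat.lt_floor_add_one (1 + Real.log (n / x))).le
  have h5 : ((⌊1 + Real.log (n / x)⌋₊ : ℝ) + 1) ≤ 2 ^ (sparsityLevel n x + 1) := by
    exact_mod_cast h3
  rw [pow_succ] at h5
  linarith

lemma subsetEntropy_le_two_pow_mul (h0 : 0 ≤ x) :
    subsetEntropy n x ≤ 2 * (2 : ℝ) ^ sparsityLevel n x * x := by
  rw [subsetEntropy, mul_comm]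
  exact mul_le_mul_of_nonneg_right one_add_log_le_two_pow h0

/-- The density of a fibre is doubly exponentially small in its level. All gains over the entropy
come from here. -/
lemma div_le_exp_sparsityLevel (hn : 1 ≤ n) (h0 : 0 ≤ x) (hx : x ≤ n) :
    x / n ≤ Real.exp (1 - 2 ^ sparsityLevel n x) := by
  have hn0 : (0 : ℝ) < n := by exact_mod_cast hn
  rcases h0.eq_or_lt with rfl | h0
  · simp [Real.exp_nonneg]
  · have h1 := two_pow_sparsityLevel_le h0.le hx
    calc x / n = Real.exp (1 - (1 + Real.log (n / x))) := by
          rw [sub_add_cancel_left, Real.exp_neg, Real.exp_log (by positivity), inv_div]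
      _ ≤ _ := Real.exp_le_exp.2 (by linarith)

end Levels

section LevelSums

variable {V E : Type*} [Fintype V] [Fintype E]

/-- The sum of `f` over the elements whose level belongs to `P`. -/
def levelSum (lev : V → ℕ) (f : V → ℝ) (P : Finset ℕ) : ℝ := ∑ u with lev u ∈ P, f u

/-- The sum of `f` over the elements whose two levels belong to `P` and to `Q`. -/
def levelSum₂ (lev lev' : E → ℕ) (f : E → ℝ) (P Q : Finset ℕ) : ℝ :=
  ∑ e with lev e ∈ P ∧ lev' e ∈ Q, f e

lemma levelSum_eq_sum (lev : V → ℕ) (f : V → ℝ) (P : Finset ℕ) :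
    levelSum lev f P = ∑ p ∈ P, levelSum lev f {p} := by
  simp only [levelSum, sum_filter, mem_singleton]
  rw [sum_comm]
  exact sum_congr rfl fun u _ => by simp

lemma levelSum₂_eq_sum (lev lev' : E → ℕ) (f : E → ℝ) (P Q : Finset ℕ) :
    levelSum₂ lev lev' f P Q = ∑ p ∈ P, ∑ q ∈ Q, levelSum₂ lev lev' f {p} {q} := by
  simp only [levelSum₂, sum_filter, mem_singleton]
  rw [sum_congr rfl fun p _ => sum_comm, sum_comm]
  refine sum_congr rfl fun e _ => ?_
  simp only [ite_and]
  split_ifs <;> simp [*]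

lemma levelSum₂_comm (lev lev' : E → ℕ) (f : E → ℝ) (P Q : Finset ℕ) :
    levelSum₂ lev lev' f P Q = levelSum₂ lev' lev f Q P := by
  simp only [levelSum₂, and_comm]

lemma levelSum_nonneg {lev : V → ℕ} {f : V → ℝ} (hf : ∀ u, 0 ≤ f u) (P : Finset ℕ) :
    0 ≤ levelSum lev f P := sum_nonneg fun u _ => hf u

lemma levelSum₂_nonneg {lev lev' : E → ℕ} {f : E → ℝ} (hf : ∀ u, 0 ≤ f u) (P Q : Finset ℕ) :
    0 ≤ levelSum₂ lev lev' f P Q := sum_nonneg fun u _ => hf u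

lemma levelSum_mono {lev : V → ℕ} {f : V → ℝ} (hf : ∀ u, 0 ≤ f u) {P Q : Finset ℕ} (h : P ⊆ Q) :
    levelSum lev f P ≤ levelSum lev f Q :=
  sum_le_sum_of_subset_of_nonneg (monotone_filter_right _ fun _ _ hu => h hu) fun u _ _ => hf u

lemma levelSum_le_sum {lev : V → ℕ} {f : V → ℝ} (hf : ∀ u, 0 ≤ f u) (P : Finset ℕ) :
    levelSum lev f P ≤ ∑ u, f u :=
  sum_le_sum_of_subset_of_nonneg (subset_univ _) fun u _ _ => hf u

end LevelSums

lemma sum_half_pow_le {P : Finset ℕ} {p : ℕ} (hP : ∀ q ∈ P, p ≤ q) :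
    ∑ q ∈ P, ((2 : ℝ) ^ q)⁻¹ ≤ 2 * ((2 : ℝ) ^ p)⁻¹ := by
  have key : ∀ N, ∑ q ∈ range N, ((2 : ℝ) ^ (p + q))⁻¹ =
      2 * ((2 : ℝ) ^ p)⁻¹ - 2 * ((2 : ℝ) ^ (p + N))⁻¹ := by
    intro N
    induction N with
    | zero => simp
    | succ N ih =>
      rw [sum_range_succ, ih, ← add_assoc, pow_succ (2 : ℝ) (p + N)]
      field_simp
      ring
  have h1 : P ⊆ (range (P.sup id + 1)).map (addLeftEmbedding p) := by
    intro q hq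
    have h2 : q ≤ P.sup id := le_sup (f := id) hq
    have := hP q hq
    exact mem_map.2 ⟨q - p, mem_range.2 (by omega), by simp; omega⟩
  refine (sum_le_sum_of_subset_of_nonneg h1 fun _ _ _ => by positivity).trans ?_
  rw [sum_map]
  simp only [addLeftEmbedding_apply]
  rw [key]
  have : (0 : ℝ) ≤ 2 * ((2 : ℝ) ^ (p + (P.sup id + 1)))⁻¹ := by positivity
  linarith

/-! ### Discrepancy from Chernoff bounds that pay for the entropy -/

/-- Nonnegative quantities `X` on the edges of a bipartite graph of maximum degree `d` on two copies
of `V` whose sums over products of subsets obey Chernoff bounds around those of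
`s (src e) * t (tgt e) / n`, at a level given by the entropies of subsets of sizes `s` and `t` of
an `n`-set. -/
structure IsMixing {V E : Type*} [Fintype V] [Fintype E] (src tgt : E → V) (s t : V → ℝ)
    (X : E → ℝ) (n : ℕ) (d : ℝ) : Prop where
  one_le : 1 ≤ n
  left_nonneg : ∀ u, 0 ≤ s u
  left_le : ∀ u, s u ≤ n
  right_nonneg : ∀ v, 0 ≤ t v
  right_le : ∀ v, t v ≤ n
  nonneg : ∀ e, 0 ≤ X e
  left_degree : ∀ f : V → ℝ, (∀ u, 0 ≤ f u) → ∑ e, f (src e) ≤ d * ∑ u, f u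
  right_degree : ∀ f : V → ℝ, (∀ v, 0 ≤ f v) → ∑ e, f (tgt e) ≤ d * ∑ v, f v
  -- Whole sets of levels are allowed, so that a block of levels can be tested against a single
  -- level whose entropy is then paid only once.
  deviation : ∀ P Q : Finset ℕ, ∀ μ H,
    levelSum₂ (fun e => sparsityLevel n (s (src e))) (fun e => sparsityLevel n (t (tgt e)))
      (fun e => s (src e) * t (tgt e) / n) P Q = μ →
    levelSum (fun u => sparsityLevel n (s u)) (fun u => subsetEntropy n (s u)) P +
      levelSum (fun u => sparsityLevel n (t u)) (fun u => subsetEntropy n (t u)) Q = H →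
    |levelSum₂ (fun e => sparsityLevel n (s (src e))) (fun e => sparsityLevel n (t (tgt e))) X P Q
      - μ| ≤ 2 * max √(102 * H * μ) (102 * H)
  heavy : ∀ P Q : Finset ℕ, ∀ μ H L,
    levelSum₂ (fun e => sparsityLevel n (s (src e))) (fun e => sparsityLevel n (t (tgt e)))
      (fun e => s (src e) * t (tgt e) / n) P Q = μ →
    levelSum (fun u => sparsityLevel n (s u)) (fun u => subsetEntropy n (s u)) P +
      levelSum (fun u => sparsityLevel n (t u)) (fun u => subsetEntropy n (t u)) Q = H →
    Real.exp L * μ ≤ 8 * H →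
    L * levelSum₂ (fun e => sparsityLevel n (s (src e))) (fun e => sparsityLevel n (t (tgt e)))
      X P Q ≤ 110 * H

namespace IsMixing

variable {V E : Type*} [Fintype V] [Fintype E] {src tgt : E → V} {s t : V → ℝ} {X : E → ℝ} {n : ℕ}
  {d : ℝ}

lemma symm (h : IsMixing src tgt s t X n d) : IsMixing tgt src t s X n d where
  one_le := h.one_le
  left_nonneg := h.right_nonneg
  left_le := h.right_le
  right_nonneg := h.left_nonneg
  right_le := h.left_le
  nonneg := h.nonneg
  left_degree := h.right_degree
  right_degree := h.left_degree
  deviation := by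
    intro P Q μ H hμ hH
    rw [levelSum₂_comm]
    refine h.deviation Q P μ H ?_ (by rw [add_comm]; exact hH)
    rw [levelSum₂_comm, ← hμ]
    simp only [mul_comm]
  heavy := by
    intro P Q μ H L hμ hH hL
    rw [levelSum₂_comm]
    refine h.heavy Q P μ H L ?_ (by rw [add_comm]; exact hH) hL
    rw [levelSum₂_comm, ← hμ]
    simp only [mul_comm]

/-- The total size of the left fibres with level in `P`. -/
noncomputable def size (s : V → ℝ) (n : ℕ) (P : Finset ℕ) : ℝ :=
  levelSum (fun u => sparsityLevel n (s u)) s P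

/-- The total entropy of the fibres with level in `P`. -/
noncomputable def ent (s : V → ℝ) (n : ℕ) (P : Finset ℕ) : ℝ :=
  levelSum (fun u => sparsityLevel n (s u)) (fun u => subsetEntropy n (s u)) P

/-- The sum of `f` over the edges with left level in `P` and right level in `Q`. -/
noncomputable def edgeSum (src tgt : E → V) (s t : V → ℝ) (n : ℕ) (f : E → ℝ) (P Q : Finset ℕ) :
    ℝ :=
  levelSum₂ (fun e => sparsityLevel n (s (src e))) (fun e => sparsityLevel n (t (tgt e))) f P Q

variable (h : IsMixing src tgt s t X n d)

include h

lemma size_nonneg (P : Finset ℕ) : 0 ≤ size s n P := levelSum_nonneg h.left_nonneg P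

lemma ent_nonneg (P : Finset ℕ) : 0 ≤ ent s n P :=
  levelSum_nonneg (fun u => subsetEntropy_nonneg (h.left_nonneg u) (h.left_le u)) P

lemma mean_nonneg (e : E) : 0 ≤ s (src e) * t (tgt e) / n :=
  div_nonneg (mul_nonneg (h.left_nonneg _) (h.right_nonneg _)) (Nat.cast_nonneg n)

lemma ent_le (p : ℕ) : ent s n {p} ≤ 2 * 2 ^ p * size s n {p} := by
  rw [ent, size, levelSum, levelSum, mul_sum]
  refine sum_le_sum fun u hu => ?_
  have hp : sparsityLevel n (s u) = p := by simpa using hu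
  rw [← hp]
  exact subsetEntropy_le_two_pow_mul (h.left_nonneg u)

lemma ent_mono {P Q : Finset ℕ} (hPQ : P ⊆ Q) : ent s n P ≤ ent s n Q :=
  levelSum_mono (fun u => subsetEntropy_nonneg (h.left_nonneg u) (h.left_le u)) hPQ

/-- Every left fibre at level `p` has density at most `exp (1 - 2^p)`, and each right vertex is
counted at most `d` times. -/
lemma mean_le (p : ℕ) (Q : Finset ℕ) :
    edgeSum src tgt s t n (fun e => s (src e) * t (tgt e) / n) {p} Q ≤
      3 * Real.exp (-2 ^ p) * (d * size t n Q) := by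
  have e1 : Real.exp (1 - 2 ^ p) ≤ 3 * Real.exp (-2 ^ p) := by
    rw [sub_eq_add_neg, Real.exp_add]
    exact mul_le_mul_of_nonneg_right (by linarith [Real.exp_one_lt_d9]) (Real.exp_pos _).le
  set f : V → ℝ := fun v => if sparsityLevel n (t v) ∈ Q then t v else 0
  have hf : ∀ v, 0 ≤ f v := fun v => by
    simp only [f]; split_ifs
    · exact h.right_nonneg v
    · exact le_rfl
  have h1 := h.right_degree f hf
  have h2 : ∑ v, f v = size t n Q := by
    simp only [f, size, levelSum, sum_filter]
  rw [h2] at h1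
  refine le_trans ?_ (mul_le_mul_of_nonneg_left h1 (by positivity))
  rw [edgeSum, levelSum₂, sum_filter, mul_sum]
  refine sum_le_sum fun e _ => ?_
  split_ifs with he
  · have hp : sparsityLevel n (s (src e)) = p := by simpa using he.1
    simp only [f, he.2, if_true]
    rw [mul_comm (s (src e)), mul_div_assoc, mul_comm]
    refine mul_le_mul_of_nonneg_right ?_ (h.right_nonneg _)
    have := div_le_exp_sparsityLevel h.one_le (h.left_nonneg (src e)) (h.left_le (src e))
    rw [hp] at this
    exact this.trans e1
  · exact mul_nonneg (by positivity) (hf _)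

/-- The deviation when the entropy is at most `M` times the mean. -/
lemma deviation_of_le {P Q : Finset ℕ} {μ H M : ℝ}
    (hμ : edgeSum src tgt s t n (fun e => s (src e) * t (tgt e) / n) P Q = μ)
    (hH : ent s n P + ent t n Q = H) (hM : 1 ≤ M) (hle : H ≤ M * μ) :
    |edgeSum src tgt s t n X P Q - μ| ≤ 204 * √(M * (H * μ)) := by
  have hμ0 : 0 ≤ μ := by rw [← hμ]; exact levelSum₂_nonneg h.mean_nonneg _ _
  have hH0 : 0 ≤ H := by rw [← hH]; exact add_nonneg (h.ent_nonneg P) (h.symm.ent_nonneg Q)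
  refine (h.deviation P Q μ H hμ hH).trans ?_
  have e1 : √(102 * H * μ) ≤ 102 * √(M * (H * μ)) := by
    rw [show (102 : ℝ) = √(102 ^ 2) by rw [Real.sqrt_sq (by norm_num)], ← Real.sqrt_mul (by norm_num),
      Real.sqrt_sq (by norm_num)]
    refine Real.sqrt_le_sqrt ?_
    have : 0 ≤ H * μ := by positivity
    nlinarith
  -- Here `H ≤ M μ` gives `H² ≤ M H μ`.
  have e2 : 102 * H ≤ 102 * √(M * (H * μ)) := by
    refine mul_le_mul_of_nonneg_left (Real.le_sqrt_of_sq_le ?_) (by norm_num)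
    nlinarith
  have := max_le e1 e2
  linarith

end IsMixing

lemma pow_mul_exp_neg_le {x : ℝ} (hx : 0 ≤ x) (k : ℕ) : x ^ k * Real.exp (-x) ≤ k.factorial := by
  have := Real.pow_div_factorial_le_exp x hx k
  rw [div_le_iff₀ (by positivity)] at this
  rw [Real.exp_neg, ← div_eq_mul_inv, div_le_iff₀ (Real.exp_pos _), mul_comm]
  linarith

namespace IsMixing

lemma edgeSum_eq_sum {V E : Type*} [Fintype E] {src tgt : E → V} {s t : V → ℝ} {n : ℕ}
    (f : E → ℝ) (P Q : Finset ℕ) :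
    edgeSum src tgt s t n f P Q = ∑ p ∈ P, ∑ q ∈ Q, edgeSum src tgt s t n f {p} {q} :=
  levelSum₂_eq_sum _ _ _ _ _

variable {V E : Type*} [Fintype V] [Fintype E] {src tgt : E → V} {s t : V → ℝ} {X : E → ℝ} {n : ℕ}
  {d : ℝ}

lemma ent_eq_sum (P : Finset ℕ) : ent s n P = ∑ p ∈ P, ent s n {p} := levelSum_eq_sum _ _ _

lemma size_eq_sum (P : Finset ℕ) : size s n P = ∑ p ∈ P, size s n {p} := levelSum_eq_sum _ _ _

variable (h : IsMixing src tgt s t X n d)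

include h

lemma abs_sub_le_of_le {P Q : Finset ℕ} {μ B : ℝ}
    (hμ : edgeSum src tgt s t n (fun e => s (src e) * t (tgt e) / n) P Q = μ)
    (h1 : edgeSum src tgt s t n X P Q ≤ B) (h2 : μ ≤ B) :
    |edgeSum src tgt s t n X P Q - μ| ≤ B := by
  have hμ0 : 0 ≤ μ := by rw [← hμ]; exact levelSum₂_nonneg h.mean_nonneg _ _
  have hX0 : 0 ≤ edgeSum src tgt s t n X P Q := levelSum₂_nonneg h.nonneg _ _
  rw [abs_sub_le_iff]
  exact ⟨by linarith, by linarith⟩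

lemma size_le_sum (P : Finset ℕ) : size s n P ≤ ∑ u, s u := levelSum_le_sum h.left_nonneg P

/-- Two levels of comparable entropies between which there are not too few edges. -/
lemma deviation_light (hd : 0 ≤ d) {p q : ℕ} {μ : ℝ}
    (hμ : edgeSum src tgt s t n (fun e => s (src e) * t (tgt e) / n) {p} {q} = μ)
    (h1 : ent s n {p} ≤ Real.exp (2 ^ q / 8) * ent t n {q})
    (h2 : ent s n {p} + ent t n {q} ≤ Real.exp (2 ^ q / 4) * μ) :
    |edgeSum src tgt s t n X {p} {q} - μ| ≤
      25092 * √(d * (∑ u, s u) * ∑ v, t v) * (((2 : ℝ) ^ q)⁻¹ * ((2 : ℝ) ^ q)⁻¹) := by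
  have hμ' : μ ≤ 3 * Real.exp (-2 ^ q) * (d * ∑ u, s u) := by
    rw [← hμ, edgeSum, levelSum₂_comm]
    have := h.symm.mean_le q {p}
    simp only [edgeSum, mul_comm (t _)] at this
    refine this.trans ?_
    gcongr
    exact h.size_le_sum {p}
  have hg : ent t n {q} ≤ 2 * 2 ^ q * ∑ v, t v := by
    refine (h.symm.ent_le q).trans ?_
    gcongr
    exact h.symm.size_le_sum {q}
  have hS : 0 ≤ ∑ u, s u := sum_nonneg fun u _ => h.left_nonneg u
  have hT : 0 ≤ ∑ v, t v := sum_nonneg fun u _ => h.right_nonneg u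
  have hμ0 : 0 ≤ μ := by rw [← hμ]; exact levelSum₂_nonneg h.mean_nonneg _ _
  have hg0 := h.symm.ent_nonneg {q}
  have hp0 := h.ent_nonneg {p}
  set y : ℝ := 2 ^ q with hy
  have hy0 : 0 < y := by positivity
  have hE : 1 ≤ Real.exp (y / 8) := Real.one_le_exp (by positivity)
  have hE' : 1 ≤ Real.exp (y / 4) := Real.one_le_exp (by positivity)
  refine (h.deviation_of_le hμ rfl hE' h2).trans ?_
  have hH : ent s n {p} + ent t n {q} ≤ 2 * Real.exp (y / 8) * (2 * y * ∑ v, t v) := by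
    have a1 := mul_le_mul_of_nonneg_left hg (Real.exp_pos (y / 8)).le
    have a2 := mul_le_mul_of_nonneg_right hE hg0
    linarith
  -- The exponents `1/4 + 1/8 - 1 = -5/8` leave a decaying exponential, which is traded for powers
  -- by `x⁵ exp (-x) ≤ 120` at `x = 5y/8`.
  have hexp : y * Real.exp (y / 4) * Real.exp (y / 8) * Real.exp (-y) ≤ 1259 * y⁻¹ ^ 4 := by
    have a := pow_mul_exp_neg_le (x := 5 * y / 8) (by positivity) 5
    have b : Real.exp (y / 4) * Real.exp (y / 8) * Real.exp (-y) = Real.exp (-(5 * y / 8)) := by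
      rw [← Real.exp_add, ← Real.exp_add]; ring_nf
    rw [mul_assoc, mul_assoc, ← mul_assoc (Real.exp (y / 4)), b, inv_pow, ← div_eq_mul_inv, le_div_iff₀ (by positivity)]
    norm_num [Nat.factorial] at a
    have c : (5 * y / 8) ^ 5 = 3125 / 32768 * y ^ 5 := by ring
    rw [c] at a
    have : y * Real.exp (-(5 * y / 8)) * y ^ 4 = y ^ 5 * Real.exp (-(5 * y / 8)) := by ring
    rw [this]
    linarith
  -- Uses `12 * 1259 ≤ 123²`; then `204 * 123 = 25092`. The resulting factor `y⁻²` is enough to sum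
  -- over up to `y` levels `p` and then over `q`.
  have key : Real.exp (y / 4) * ((ent s n {p} + ent t n {q}) * μ) ≤
      (123 * (y⁻¹ * y⁻¹)) ^ 2 * (d * (∑ u, s u) * ∑ v, t v) := by
    calc _ ≤ Real.exp (y / 4) * ((2 * Real.exp (y / 8) * (2 * y * ∑ v, t v)) *
          (3 * Real.exp (-y) * (d * ∑ u, s u))) := by gcongr
      _ = 12 * (d * (∑ u, s u) * ∑ v, t v) *
          (y * Real.exp (y / 4) * Real.exp (y / 8) * Real.exp (-y)) := by ring
      _ ≤ 12 * (d * (∑ u, s u) * ∑ v, t v) * (1259 * y⁻¹ ^ 4) := by gcongr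
      _ ≤ _ := by
        have : 0 ≤ (d * (∑ u, s u) * ∑ v, t v) * y⁻¹ ^ 4 := by positivity
        nlinarith
  have := Real.sqrt_le_sqrt key
  rw [Real.sqrt_mul (sq_nonneg (123 * (y⁻¹ * y⁻¹))), Real.sqrt_sq (by positivity)] at this
  linarith

/-- Few expected edges from the levels in `P` to a sparser level. -/
lemma deviation_heavy {P : Finset ℕ} {q : ℕ} (hP : ∀ p ∈ P, p ≤ q)
    (h1 : ∀ p ∈ P, Real.exp (2 ^ q / 4) *
      edgeSum src tgt s t n (fun e => s (src e) * t (tgt e) / n) {p} {q} ≤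
        ent s n {p} + ent t n {q}) :
    |edgeSum src tgt s t n X P {q} -
      edgeSum src tgt s t n (fun e => s (src e) * t (tgt e) / n) P {q}| ≤
      880 * ((2 : ℝ) ^ q)⁻¹ * (ent s n P + ent t n {q}) := by
  set μ := edgeSum src tgt s t n (fun e => s (src e) * t (tgt e) / n) P {q} with hμ
  set H := ent s n P + ent t n {q} with hH
  have hg0 := h.symm.ent_nonneg {q}
  have hp0 := h.ent_nonneg P
  have hH0 : 0 ≤ H := add_nonneg hp0 hg0
  -- There are at most `q + 1 ≤ 2^q` levels in `P`, and this loss is absorbed by the exponential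
  -- factor.
  have hy1 : (q : ℝ) + 1 ≤ 2 ^ q := by exact_mod_cast (Nat.lt_two_pow_self (n := q))
  have hμH : Real.exp (2 ^ q / 4) * μ ≤ 2 ^ q * H := by
    have e1 : μ = ∑ p ∈ P, edgeSum src tgt s t n (fun e => s (src e) * t (tgt e) / n) {p} {q} := by
      rw [hμ, edgeSum_eq_sum]; simp
    have e2 : ∀ p ∈ P, Real.exp (2 ^ q / 4) *
        edgeSum src tgt s t n (fun e => s (src e) * t (tgt e) / n) {p} {q} ≤ H := by
      intro p hp
      refine (h1 p hp).trans ?_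
      have := h.ent_mono (singleton_subset_iff.2 hp)
      linarith
    have e3 : (P.card : ℝ) ≤ 2 ^ q := by
      have : P ⊆ range (q + 1) := fun p hp => mem_range.2 (Nat.lt_succ_of_le (hP p hp))
      have h2 := card_le_card this
      rw [card_range] at h2
      exact le_trans (by exact_mod_cast h2) hy1
    rw [e1, mul_sum]
    refine (sum_le_sum e2).trans ?_
    rw [sum_const, nsmul_eq_mul]
    exact mul_le_mul_of_nonneg_right e3 hH0
  set y : ℝ := 2 ^ q with hy
  have hy0 : 0 < y := by positivity
  have hsplit : Real.exp (y / 4) = Real.exp (y / 8) * Real.exp (y / 8) := by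
    rw [← Real.exp_add]; ring_nf
  have hμ0 : 0 ≤ μ := levelSum₂_nonneg h.mean_nonneg _ _
  -- Half of `exp (y / 4)` absorbs the factor `y ≤ 8 exp (y / 8)`. The other half allows `heavy`
  -- with `L = y / 8`, hence the constant `8 * 110 = 880`.
  have hL : Real.exp (y / 8) * μ ≤ 8 * H := by
    have a : y / 8 ≤ Real.exp (y / 8) := by linarith [Real.add_one_le_exp (y / 8)]
    rw [hsplit] at hμH
    have b : Real.exp (y / 8) * (Real.exp (y / 8) * μ) ≤ Real.exp (y / 8) * (8 * H) := by
      nlinarith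
    exact le_of_mul_le_mul_left b (Real.exp_pos _)
  have hX := h.heavy P {q} μ H (y / 8) hμ.symm hH.symm hL
  have hXB : edgeSum src tgt s t n X P {q} ≤ 880 * y⁻¹ * H := by
    rw [mul_assoc, mul_comm y⁻¹, ← div_eq_mul_inv, ← mul_div_assoc, le_div_iff₀ hy0]
    rw [edgeSum]
    linarith
  refine h.abs_sub_le_of_le rfl hXB ?_
  have a := Real.pow_div_factorial_le_exp (y / 4) (by positivity) 2
  norm_num [Nat.factorial] at a
  have b : y * (y * μ) ≤ y * (32 * H) := by nlinarith
  have c := le_of_mul_le_mul_left b hy0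
  rw [mul_assoc, mul_comm y⁻¹, ← div_eq_mul_inv, ← mul_div_assoc, le_div_iff₀ hy0]
  linarith

/-- One level against sparser levels of much smaller entropy. -/
lemma deviation_dominated (hd : 0 ≤ d) {p : ℕ} {Q : Finset ℕ}
    (h1 : ∀ q ∈ Q, Real.exp (2 ^ q / 8) * ent t n {q} ≤ ent s n {p}) :
    |edgeSum src tgt s t n X {p} Q -
      edgeSum src tgt s t n (fun e => s (src e) * t (tgt e) / n) {p} Q| ≤
      14960 * size s n {p} + 7800 * √(d * (∑ u, s u) * ∑ v, t v) * ((2 : ℝ) ^ p)⁻¹ := by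
  set μ := edgeSum src tgt s t n (fun e => s (src e) * t (tgt e) / n) {p} Q with hμ
  set H := ent s n {p} + ent t n Q with hH
  have hg0 := h.symm.ent_nonneg Q
  have hp0 := h.ent_nonneg {p}
  have hH0 : 0 ≤ H := add_nonneg hp0 hg0
  have hμ0 : 0 ≤ μ := levelSum₂_nonneg h.mean_nonneg _ _
  have hS : 0 ≤ ∑ u, s u := sum_nonneg fun u _ => h.left_nonneg u
  have hT : 0 ≤ ∑ v, t v := sum_nonneg fun u _ => h.right_nonneg u
  have hsz := h.size_nonneg {p}
  -- Each entropy on the right is at most `8 * 2^(-q)` times that of level `p`, so together they do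
  -- not matter and the total is of order `2^p` times the size.
  have hQ : ent t n Q ≤ 16 * ent s n {p} := by
    rw [ent_eq_sum]
    have a : ∀ q ∈ Q, ent t n {q} ≤ 8 * ent s n {p} * ((2 : ℝ) ^ q)⁻¹ := by
      intro q hq
      have b := h1 q hq
      have c : (2 : ℝ) ^ q / 8 ≤ Real.exp (2 ^ q / 8) := by
        linarith [Real.add_one_le_exp ((2 : ℝ) ^ q / 8)]
      have e := mul_le_mul_of_nonneg_right c (h.symm.ent_nonneg {q})
      rw [← div_eq_mul_inv, le_div_iff₀ (by positivity)]
      linarith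
    refine (sum_le_sum a).trans ?_
    rw [← mul_sum]
    have := sum_half_pow_le (P := Q) (p := 0) (fun _ _ => Nat.zero_le _)
    norm_num at this
    nlinarith
  have hp1 := h.ent_le p
  have hH1 : H ≤ 34 * 2 ^ p * size s n {p} := by linarith
  have hμ' : μ ≤ 3 * Real.exp (-2 ^ p) * (d * ∑ v, t v) := by
    refine (h.mean_le p Q).trans ?_
    gcongr
    exact h.symm.size_le_sum Q
  have hsS := h.size_le_sum {p}
  set y : ℝ := 2 ^ p with hy
  have hy0 : 0 < y := by positivity
  have hE' : 1 ≤ Real.exp (y / 4) := Real.one_le_exp (by positivity)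
  -- Either the mean is large enough for the Gaussian bound, where `exp (-y)` beats the losses, or
  -- `heavy` applies with `L = y / 4`; its bound `110 * 34 * 4 = 14960` times the size has no factor
  -- `y` left.
  rcases le_total H (Real.exp (y / 4) * μ) with hle | hle
  · refine (h.deviation_of_le hμ.symm hH.symm hE' hle).trans ?_
    have hexp : y * Real.exp (y / 4) * Real.exp (-y) ≤ 14.25 * y⁻¹ ^ 2 := by
      have a := pow_mul_exp_neg_le (x := 3 * y / 4) (by positivity) 3
      have b : Real.exp (y / 4) * Real.exp (-y) = Real.exp (-(3 * y / 4)) := by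
        rw [← Real.exp_add]; ring_nf
      rw [mul_assoc, b, inv_pow, ← div_eq_mul_inv, le_div_iff₀ (by positivity)]
      norm_num [Nat.factorial] at a
      have c : (3 * y / 4) ^ 3 = 27 / 64 * y ^ 3 := by ring
      rw [c] at a
      have : y * Real.exp (-(3 * y / 4)) * y ^ 2 = y ^ 3 * Real.exp (-(3 * y / 4)) := by ring
      rw [this]
      linarith
    have key : Real.exp (y / 4) * (H * μ) ≤
        (38.2 * y⁻¹) ^ 2 * (d * (∑ u, s u) * ∑ v, t v) := by
      calc _ ≤ Real.exp (y / 4) * ((34 * y * ∑ u, s u) *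
            (3 * Real.exp (-y) * (d * ∑ v, t v))) := by gcongr; exact hH1.trans (by gcongr)
        _ = 102 * (d * (∑ u, s u) * ∑ v, t v) * (y * Real.exp (y / 4) * Real.exp (-y)) := by ring
        _ ≤ 102 * (d * (∑ u, s u) * ∑ v, t v) * (14.25 * y⁻¹ ^ 2) := by gcongr
        _ ≤ _ := by
          have : 0 ≤ (d * (∑ u, s u) * ∑ v, t v) * y⁻¹ ^ 2 := by positivity
          nlinarith
    have := Real.sqrt_le_sqrt key
    rw [Real.sqrt_mul (sq_nonneg (38.2 * y⁻¹)), Real.sqrt_sq (by positivity)] at this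
    have hp : 0 ≤ y⁻¹ * √(d * (∑ u, s u) * ∑ v, t v) := by positivity
    nlinarith
  · have hX := h.heavy {p} Q μ H (y / 4) hμ.symm hH.symm (by linarith)
    have hs : 0 ≤ 7800 * √(d * (∑ u, s u) * ∑ v, t v) * y⁻¹ := by positivity
    refine h.abs_sub_le_of_le rfl ?_ ?_
    · have : y * edgeSum src tgt s t n X {p} Q ≤ y * (14960 * size s n {p}) := by
        rw [edgeSum]; nlinarith
      have := le_of_mul_le_mul_left this hy0
      linarith
    · have a : y / 4 ≤ Real.exp (y / 4) := by linarith [Real.add_one_le_exp (y / 4)]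
      have : y * μ ≤ y * (14960 * size s n {p}) := by nlinarith
      have := le_of_mul_le_mul_left this hy0
      linarith

end IsMixing

namespace IsMixing

lemma sum_range_eq_edgeSum {V E : Type*} [Fintype E] {src tgt : E → V} {s t : V → ℝ} {n N : ℕ} (hs : ∀ u, sparsityLevel n (s u) < N)
    (ht : ∀ u, sparsityLevel n (t u) < N) (f : E → ℝ) :
    ∑ p ∈ range N, ∑ q ∈ range N, edgeSum src tgt s t n f {p} {q} = ∑ e, f e := by
  rw [← edgeSum_eq_sum, edgeSum, levelSum₂, filter_true_of_mem]
  intro e _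
  exact ⟨mem_range.2 (hs _), mem_range.2 (ht _)⟩

variable {V E : Type*} [Fintype V] [Fintype E] {src tgt : E → V} {s t : V → ℝ} {X : E → ℝ} {n : ℕ}
  {d : ℝ}

variable (h : IsMixing src tgt s t X n d)

include h

/-- The total deviation over pairs of levels whose right level is the sparser one. -/
lemma abs_sum_deviation_le (hd : 0 ≤ d) (R : ℕ → ℕ → Prop)
    [DecidableRel R] (hR : ∀ p q, R p q → p ≤ q) (N : ℕ) :
    |∑ q ∈ range N, ∑ p ∈ range N, if R p q then (edgeSum src tgt s t n X {p} {q} -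
      edgeSum src tgt s t n (fun e => s (src e) * t (tgt e) / n) {p} {q}) else 0| ≤
      20000 * (∑ u, s u + ∑ v, t v) + 70000 * √(d * (∑ u, s u) * ∑ v, t v) := by
  classical
  set D : ℕ → ℕ → ℝ := fun p q => edgeSum src tgt s t n X {p} {q} -
      edgeSum src tgt s t n (fun e => s (src e) * t (tgt e) / n) {p} {q} with hD
  set W := √(d * (∑ u, s u) * ∑ v, t v)
  have hW : 0 ≤ W := Real.sqrt_nonneg _
  have hDsum : ∀ P Q : Finset ℕ, edgeSum src tgt s t n X P Q -
      edgeSum src tgt s t n (fun e => s (src e) * t (tgt e) / n) P Q = ∑ p ∈ P, ∑ q ∈ Q, D p q := by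
    intro P Q
    rw [edgeSum_eq_sum, edgeSum_eq_sum (fun e => s (src e) * t (tgt e) / n)]
    simp only [hD, sum_sub_distrib]
  -- Three cases for a pair of levels: the entropy at `q` is negligible; or there are few expected
  -- edges; or neither. In the first case the levels `q` are grouped for each `p`, in the second the
  -- levels `p` for each `q`.
  let Dom : ℕ → ℕ → Prop := fun p q => Real.exp (2 ^ q / 8) * ent t n {q} ≤ ent s n {p}
  let Hvy : ℕ → ℕ → Prop := fun p q => Real.exp (2 ^ q / 4) *
      edgeSum src tgt s t n (fun e => s (src e) * t (tgt e) / n) {p} {q} ≤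
        ent s n {p} + ent t n {q}
  let Qs : ℕ → Finset ℕ := fun p => (range N).filter fun q => R p q ∧ Dom p q
  let Ps : ℕ → Finset ℕ := fun q => (range N).filter fun p => R p q ∧ ¬ Dom p q ∧ Hvy p q
  let Ls : ℕ → Finset ℕ := fun q => (range N).filter fun p => R p q ∧ ¬ Dom p q ∧ ¬ Hvy p q
  have hsplit : ∑ q ∈ range N, ∑ p ∈ range N, (if R p q then D p q else 0) =
      ∑ p ∈ range N, ∑ q ∈ Qs p, D p q + ∑ q ∈ range N, ∑ p ∈ Ps q, D p q +
        ∑ q ∈ range N, ∑ p ∈ Ls q, D p q := by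
    simp only [Qs, Ps, Ls, sum_filter]
    rw [sum_comm (s := range N) (t := range N) (f := fun p q => if R p q ∧ Dom p q then D p q else 0),
      ← sum_add_distrib, ← sum_add_distrib]
    refine sum_congr rfl fun q _ => ?_
    rw [← sum_add_distrib, ← sum_add_distrib]
    refine sum_congr rfl fun p _ => ?_
    by_cases h1 : R p q <;> by_cases h2 : Dom p q <;> by_cases h3 : Hvy p q <;> simp [h1, h2, h3]
  have hsize : ∀ {s : V → ℝ}, (∀ u, 0 ≤ s u) → ∑ p ∈ range N, size s n {p} ≤ ∑ u, s u := by
    intro s hs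
    rw [← size_eq_sum]
    exact levelSum_le_sum hs _
  have hgeom : ∑ q ∈ range N, ((2 : ℝ) ^ q)⁻¹ ≤ 2 := by
    have := sum_half_pow_le (P := range N) (p := 0) fun _ _ => Nat.zero_le _
    simpa using this
  have b1 : |∑ p ∈ range N, ∑ q ∈ Qs p, D p q| ≤ 14960 * ∑ u, s u + 15600 * W := by
    have e : ∀ p ∈ range N, |∑ q ∈ Qs p, D p q| ≤
        14960 * size s n {p} + 7800 * W * ((2 : ℝ) ^ p)⁻¹ := by
      intro p _
      have e1 := h.deviation_dominated hd (p := p) (Q := Qs p) fun q hq => (mem_filter.1 hq).2.2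
      rwa [hDsum, sum_singleton] at e1
    refine (abs_sum_le_sum_abs _ _).trans ((sum_le_sum e).trans ?_)
    rw [sum_add_distrib, ← mul_sum, ← mul_sum]
    have e2 := hsize h.left_nonneg
    nlinarith
  have b2 : |∑ q ∈ range N, ∑ p ∈ Ps q, D p q| ≤ 880 * (4 * ∑ u, s u + 2 * ∑ v, t v) := by
    have e : ∀ q ∈ range N, |∑ p ∈ Ps q, D p q| ≤
        880 * (∑ p ∈ range N, (if p ≤ q then 2 * 2 ^ p * size s n {p} * ((2 : ℝ) ^ q)⁻¹ else 0) +
          2 * size t n {q}) := by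
      intro q _
      have e1 := h.deviation_heavy (P := Ps q) (q := q)
        (fun p hp => hR p q (mem_filter.1 hp).2.1) fun p hp => (mem_filter.1 hp).2.2.2
      rw [hDsum, sum_congr rfl fun p _ => sum_singleton (D p) q] at e1
      refine e1.trans ?_
      rw [mul_assoc, mul_add]
      refine mul_le_mul_of_nonneg_left (add_le_add ?_ ?_) (by norm_num)
      · rw [ent_eq_sum, mul_sum, ← sum_filter]
        have hsub : Ps q ⊆ (range N).filter fun p => p ≤ q := fun p hp =>
          mem_filter.2 ⟨(mem_filter.1 hp).1, hR p q (mem_filter.1 hp).2.1⟩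
        refine (sum_le_sum_of_subset_of_nonneg hsub fun p _ _ =>
          mul_nonneg (by positivity) (h.ent_nonneg {p})).trans (sum_le_sum fun p _ => ?_)
        rw [mul_comm]
        exact mul_le_mul_of_nonneg_right (h.ent_le p) (by positivity)
      · have e2 := h.symm.ent_le q
        rw [inv_mul_le_iff₀ (by positivity)]
        linarith
    refine (abs_sum_le_sum_abs _ _).trans ((sum_le_sum e).trans ?_)
    rw [← mul_sum, sum_add_distrib, ← mul_sum, sum_comm]
    refine mul_le_mul_of_nonneg_left (add_le_add ?_ ?_) (by norm_num)
    · refine le_trans (sum_le_sum (g := fun p => 4 * size s n {p}) fun p _ => ?_) ?_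
      -- The entropy factor `2^p` is recovered from the factors `2^(-q)`, because only `q ≥ p`
      -- occur.
      · rw [← sum_filter, ← mul_sum]
        have e3 := sum_half_pow_le (P := (range N).filter fun q => p ≤ q) (p := p)
          fun q hq => (mem_filter.1 hq).2
        have e4 := mul_le_mul_of_nonneg_left e3
          (mul_nonneg (by positivity : (0 : ℝ) ≤ 2 * 2 ^ p) (h.size_nonneg {p}))
        refine e4.trans (le_of_eq ?_)
        field_simp
        ring
      · rw [← mul_sum]
        exact mul_le_mul_of_nonneg_left (hsize h.left_nonneg) (by norm_num)
    · exact mul_le_mul_of_nonneg_left (hsize h.right_nonneg) (by norm_num)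
  have b3 : |∑ q ∈ range N, ∑ p ∈ Ls q, D p q| ≤ 50184 * W := by
    have e : ∀ q ∈ range N, |∑ p ∈ Ls q, D p q| ≤ 25092 * W * ((2 : ℝ) ^ q)⁻¹ := by
      intro q _
      have e1 : ∀ p ∈ Ls q, |D p q| ≤ 25092 * W * (((2 : ℝ) ^ q)⁻¹ * ((2 : ℝ) ^ q)⁻¹) := by
        intro p hp
        have hp' := (mem_filter.1 hp).2
        exact h.deviation_light hd rfl (not_le.1 hp'.2.1).le (not_le.1 hp'.2.2).le
      refine (abs_sum_le_sum_abs _ _).trans ((sum_le_sum e1).trans ?_)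
      rw [sum_const, nsmul_eq_mul]
      have hc : ((Ls q).card : ℝ) ≤ 2 ^ q := by
        have : Ls q ⊆ range (q + 1) := fun p hp =>
          mem_range.2 (Nat.lt_succ_of_le (hR p q (mem_filter.1 hp).2.1))
        have h2 := card_le_card this
        rw [card_range] at h2
        exact_mod_cast h2.trans (Nat.lt_two_pow_self (n := q))
      refine (mul_le_mul_of_nonneg_right hc (by positivity)).trans (le_of_eq ?_)
      field_simp
    refine (abs_sum_le_sum_abs _ _).trans ((sum_le_sum e).trans ?_)
    rw [← mul_sum]
    nlinarith
  rw [hsplit]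
  have hS : 0 ≤ ∑ u, s u := sum_nonneg fun u _ => h.left_nonneg u
  have hT : 0 ≤ ∑ v, t v := sum_nonneg fun u _ => h.right_nonneg u
  refine ((abs_add_le _ _).trans (add_le_add_left (abs_add_le _ _) _)).trans ?_
  linarith

/-- The discrepancy bound: Chernoff bounds that only pay for the entropies imply a deviation of the
order of the one of a random bipartite graph of degree `d`. -/
theorem discrepancy (hd : 0 ≤ d) :
    |∑ e, X e - ∑ e, s (src e) * t (tgt e) / n| ≤
      140000 * (√(d * (∑ u, s u) * ∑ v, t v) + ∑ u, s u + ∑ v, t v) := by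
  obtain ⟨N, hs, ht⟩ : ∃ N, (∀ u, sparsityLevel n (s u) < N) ∧ ∀ u, sparsityLevel n (t u) < N := by
    refine ⟨univ.sup (fun u => sparsityLevel n (s u)) + univ.sup (fun u => sparsityLevel n (t u)) + 1,
      fun u => ?_, fun u => ?_⟩
    · have := le_sup (f := fun u => sparsityLevel n (s u)) (mem_univ u)
      omega
    · have := le_sup (f := fun u => sparsityLevel n (t u)) (mem_univ u)
      omega
  -- The second sum, with the sides exchanged, uses the strict order, so that equal levels are
  -- counted once.
  have h1 := h.abs_sum_deviation_le hd (fun p q => p ≤ q) (fun _ _ h => h) N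
  have h2 := h.symm.abs_sum_deviation_le hd (fun p q => p < q) (fun _ _ h => h.le) N
  have e1 : ∀ f : E → ℝ, ∀ p q, edgeSum tgt src t s n f {p} {q} = edgeSum src tgt s t n f {q} {p} :=
    fun f p q => levelSum₂_comm _ _ _ _ _
  have e2 : ∑ e, X e - ∑ e, s (src e) * t (tgt e) / n =
      (∑ q ∈ range N, ∑ p ∈ range N, if p ≤ q then (edgeSum src tgt s t n X {p} {q} -
        edgeSum src tgt s t n (fun e => s (src e) * t (tgt e) / n) {p} {q}) else 0) +
      ∑ q ∈ range N, ∑ p ∈ range N, if p < q then (edgeSum tgt src t s n X {p} {q} -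
        edgeSum tgt src t s n (fun e => t (tgt e) * s (src e) / n) {p} {q}) else 0 := by
    rw [← sum_range_eq_edgeSum (src := src) (tgt := tgt) hs ht X,
      ← sum_range_eq_edgeSum (src := src) (tgt := tgt) hs ht (fun e => s (src e) * t (tgt e) / n),
      ← sum_sub_distrib, sum_comm (s := range N) (t := range N) (f := fun q p => if p ≤ q then
        (edgeSum src tgt s t n X {p} {q} -
        edgeSum src tgt s t n (fun e => s (src e) * t (tgt e) / n) {p} {q}) else 0),
      ← sum_add_distrib]
    refine sum_congr rfl fun p _ => ?_
    rw [← sum_sub_distrib, ← sum_add_distrib]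
    refine sum_congr rfl fun q _ => ?_
    simp only [e1, mul_comm (t _)]
    rcases le_or_gt p q with hpq | hpq
    · simp [hpq, not_lt.2 hpq]
    · simp [hpq, not_le.2 hpq]
  rw [mul_right_comm d (∑ v, t v) (∑ u, s u)] at h2
  rw [e2]
  refine (abs_add_le _ _).trans ((add_le_add h1 h2).trans ?_)
  have hS : 0 ≤ ∑ u, s u := sum_nonneg fun u _ => h.left_nonneg u
  have hT : 0 ≤ ∑ v, t v := sum_nonneg fun u _ => h.right_nonneg u
  linarith

end IsMixing

/-! ### Concentrated lifts satisfy the discrepancy hypotheses -/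

section Discrepancy

variable {V E : Type*} [Fintype V] [Fintype E] {n : ℕ} {src tgt : E → V}

lemma sum_comp_le_of_fiber_card_le [DecidableEq V] {g : E → V} {d : ℕ}
    (hd : ∀ u, (univ.filter fun e => g e = u).card ≤ d) (f : V → ℝ) (hf : ∀ u, 0 ≤ f u) :
    ∑ e, f (g e) ≤ d * ∑ u, f u := by
  rw [← sum_fiberwise univ g fun e => f (g e), mul_sum]
  refine sum_le_sum fun u _ => ?_
  rw [sum_congr rfl (g := fun _ => f u) fun e he => by rw [(mem_filter.1 he).2], sum_const,
    nsmul_eq_mul]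
  exact mul_le_mul_of_nonneg_right (by exact_mod_cast hd u) (hf u)

lemma IsConcentrated.isMixing [DecidableEq V] {π : E → Equiv.Perm (Fin n)} {d : ℕ} (hn : 1 ≤ n)
    (hπ : IsConcentrated src tgt π)
    (hsrc : ∀ u, (univ.filter fun e => src e = u).card ≤ d)
    (htgt : ∀ u, (univ.filter fun e => tgt e = u).card ≤ d) (S T : V → Finset (Fin n)) :
    IsMixing src tgt (fun u => (S u).card) (fun v => (T v).card) (crossings src tgt π S T) n d := by
  have hle : ∀ A : Finset (Fin n), (A.card : ℝ) ≤ n := fun A => by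
    exact_mod_cast (card_le_univ A).trans_eq (Fintype.card_fin n)
  -- Emptying all fibres whose level is not in `P` gives another family of sets, to which
  -- concentration applies as well.
  let res : (V → Finset (Fin n)) → Finset ℕ → V → Finset (Fin n) := fun S P u =>
    if sparsityLevel n (S u).card ∈ P then S u else ∅
  have hent : ∀ S P, entropy (res S P) = levelSum (fun u => sparsityLevel n (S u).card)
      (fun u => subsetEntropy n (S u).card) P := by
    intro S P
    rw [entropy, levelSum, sum_filter]
    refine sum_congr rfl fun u _ => ?_
    simp only [res]
    split_ifs
    · rfl
    · simp [subsetEntropy_zero]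
  have hmean : ∀ P Q, ∑ e, meanCrossings src tgt (res S P) (res T Q) e =
      levelSum₂ (fun e => sparsityLevel n (S (src e)).card)
        (fun e => sparsityLevel n (T (tgt e)).card)
        (fun e => ((S (src e)).card : ℝ) * (T (tgt e)).card / n) P Q := by
    intro P Q
    rw [levelSum₂, sum_filter]
    refine sum_congr rfl fun e _ => ?_
    simp only [res, meanCrossings]
    by_cases h1 : sparsityLevel n (S (src e)).card ∈ P <;>
      by_cases h2 : sparsityLevel n (T (tgt e)).card ∈ Q <;> simp [h1, h2]
  have hcross : ∀ P Q, ∑ e, crossings src tgt π (res S P) (res T Q) e =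
      levelSum₂ (fun e => sparsityLevel n (S (src e)).card)
        (fun e => sparsityLevel n (T (tgt e)).card) (crossings src tgt π S T) P Q := by
    intro P Q
    rw [levelSum₂, sum_filter]
    refine sum_congr rfl fun e _ => ?_
    simp only [res, crossings]
    by_cases h1 : sparsityLevel n (S (src e)).card ∈ P <;>
      by_cases h2 : sparsityLevel n (T (tgt e)).card ∈ Q <;> simp [h1, h2]
  exact
  { one_le := hn
    left_nonneg := fun _ => Nat.cast_nonneg _
    left_le := fun _ => hle _
    right_nonneg := fun _ => Nat.cast_nonneg _
    right_le := fun _ => hle _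
    nonneg := crossings_nonneg src tgt π S T
    left_degree := sum_comp_le_of_fiber_card_le hsrc
    right_degree := sum_comp_le_of_fiber_card_le htgt
    deviation := by
      intro P Q μ H hμ hH
      have := hπ.abs_sub_le hn (res S P) (res T Q)
      rw [hent, hent, hmean, hcross, hμ, hH] at this
      exact this
    heavy := by
      intro P Q μ H L hμ hH hL
      have := hπ.mul_le hn (res S P) (res T Q) (L := L)
      rw [hent, hent, hmean, hcross, hμ, hH] at this
      exact this hL }

end Discrepancy

/-! ### From discrepancy to norm: summation over scales -/

section ScaleSums

lemma sum_two_pow_filter_le (K m : ℕ) : ∑ l ∈ range K with l < m, (2 : ℝ) ^ l ≤ 2 ^ m := by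
  have h1 : (range K).filter (fun l => l < m) ⊆ range m := fun l hl =>
    mem_range.2 (mem_filter.1 hl).2
  refine (sum_le_sum_of_subset_of_nonneg h1 fun _ _ _ => by positivity).trans ?_
  rw [geom_sum_eq (by norm_num)]
  norm_num

lemma card_near_le (K L k : ℕ) :
    (((range K).filter fun l => k ≤ l + L ∧ l ≤ k + L).card : ℝ) ≤ 2 * L + 1 := by
  have h1 : (range K).filter (fun l => k ≤ l + L ∧ l ≤ k + L) ⊆ Icc (k - L) (k + L) := by
    intro l hl
    have := (mem_filter.1 hl).2
    exact mem_Icc.2 ⟨by omega, this.2⟩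
  have h2 := card_le_card h1
  rw [Nat.card_Icc] at h2
  have : ((range K).filter fun l => k ≤ l + L ∧ l ≤ k + L).card ≤ 2 * L + 1 := by omega
  exact_mod_cast this

/-- The converse of the expander mixing lemma of Bilu and Linial, for the matrix `D` of the
deviations between level sets of two vectors: nearby scales are controlled by the discrepancy,
distant ones by the degree. -/
lemma abs_sum_scales_le {s t : ℕ → ℝ} {D : ℕ → ℕ → ℝ} {d C : ℝ} {L : ℕ} (K : ℕ) (hd : 0 ≤ d)
    (hC : 0 ≤ C) (hs : ∀ k, 0 ≤ s k) (ht : ∀ k, 0 ≤ t k) (hL : √d ≤ 2 ^ L) (hL' : 2 ^ L ≤ 2 * √d)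
    (h1 : ∀ k l, |D k l| ≤ d * s k) (h2 : ∀ k l, |D k l| ≤ d * t l)
    (h3 : ∀ k l, |D k l| ≤ C * (√(d * s k * t l) + s k + t l)) :
    |∑ k ∈ range K, ∑ l ∈ range K, 2 ^ k * 2 ^ l * D k l| ≤
      (C * (L + 5) + 1) * √d * (∑ k ∈ range K, 4 ^ k * s k + ∑ l ∈ range K, 4 ^ l * t l) := by
  have hr := Real.sqrt_nonneg d
  have hdd : d = √d * √d := (Real.mul_self_sqrt hd).symm
  set r := √d
  have hpt : ∀ k l, |2 ^ k * 2 ^ l * D k l| ≤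
      (C * r / 2) * (if k ≤ l + L ∧ l ≤ k + L then 4 ^ k * s k else 0) +
      (C * r / 2) * (if l ≤ k + L ∧ k ≤ l + L then 4 ^ l * t l else 0) +
      (C * 2 ^ k * s k) * (if l < k + L + 1 then 2 ^ l else 0) +
      (C * 2 ^ l * t l) * (if k < l + L + 1 then 2 ^ k else 0) +
      (d * 2 ^ k * s k) * (if l < k - L then 2 ^ l else 0) +
      (d * 2 ^ l * t l) * (if k < l - L then 2 ^ k else 0) := by
    intro k l
    have hk : (0 : ℝ) ≤ 2 ^ k * 2 ^ l := by positivity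
    have a1 := hs k
    have a2 := ht l
    rw [abs_mul, abs_of_nonneg hk]
    have p1 : (0 : ℝ) ≤ (C * 2 ^ k * s k) * (if l < k + L + 1 then 2 ^ l else 0) := by positivity
    have p2 : (0 : ℝ) ≤ (C * 2 ^ l * t l) * (if k < l + L + 1 then 2 ^ k else 0) := by positivity
    -- The degree bound at the larger scale is used when the scales differ by more than `L`, the
    -- discrepancy otherwise.
    rcases lt_or_ge (l + L) k with hlt | hge
    · have e := mul_le_mul_of_nonneg_left (h1 k l) hk
      rw [if_neg (by omega), if_neg (by omega), if_pos (show l < k - L by omega),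
        if_neg (show ¬ k < l - L by omega)]
      linarith
    rcases lt_or_ge (k + L) l with hlt' | hge'
    · have e := mul_le_mul_of_nonneg_left (h2 k l) hk
      rw [if_neg (by omega), if_neg (by omega), if_neg (show ¬ l < k - L by omega),
        if_pos (show k < l - L by omega)]
      linarith
    · have e := mul_le_mul_of_nonneg_left (h3 k l) hk
      rw [if_pos ⟨hge, hge'⟩, if_pos ⟨hge', hge⟩, if_pos (show l < k + L + 1 by omega),
        if_pos (show k < l + L + 1 by omega), if_neg (show ¬ l < k - L by omega),
        if_neg (show ¬ k < l - L by omega)]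
      -- The arithmetic-geometric mean inequality for `2^k √(s k)` and `2^l √(t l)`.
      have q : 2 ^ k * 2 ^ l * √(d * s k * t l) ≤ r / 2 * (4 ^ k * s k + 4 ^ l * t l) := by
        rw [Real.sqrt_mul (by positivity), Real.sqrt_mul hd]
        have b1 := Real.mul_self_sqrt a1
        have b2 := Real.mul_self_sqrt a2
        have f1 : (4 : ℝ) ^ k = 2 ^ k * 2 ^ k := by rw [← mul_pow]; norm_num
        have f2 : (4 : ℝ) ^ l = 2 ^ l * 2 ^ l := by rw [← mul_pow]; norm_num
        have g := mul_nonneg hr (sq_nonneg (2 ^ k * √(s k) - 2 ^ l * √(t l)))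
        rw [f1, f2]
        nth_rewrite 2 [← b1]
        nth_rewrite 2 [← b2]
        simp only [r] at g ⊢
        nlinarith
      have q' := mul_le_mul_of_nonneg_left q hC
      nlinarith
  have hnear : ∀ (k : ℕ) (x : ℝ), 0 ≤ x →
      ∑ l ∈ range K, (if k ≤ l + L ∧ l ≤ k + L then x else 0) ≤ (2 * L + 1) * x := by
    intro k x hx
    rw [← sum_filter, sum_const, nsmul_eq_mul]
    exact mul_le_mul_of_nonneg_right (card_near_le K L k) hx
  have hup : ∀ k : ℕ, ∑ l ∈ range K, (if l < k + L + 1 then (2 : ℝ) ^ l else 0) ≤ 2 ^ k * (4 * r) := by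
    intro k
    rw [← sum_filter]
    refine (sum_two_pow_filter_le K _).trans ?_
    rw [pow_succ, pow_add, mul_assoc]
    exact mul_le_mul_of_nonneg_left (by linarith) (by positivity)
  -- The scales more than `L` below `k` sum to at most `2^(k - L)`, and `d ≤ √d 2^L`. For `k ≤ L`
  -- the truncated subtraction leaves no scales.
  have hdown : ∀ k : ℕ, d * ∑ l ∈ range K, (if l < k - L then (2 : ℝ) ^ l else 0) ≤ 2 ^ k * r := by
    intro k
    rw [← sum_filter]
    rcases le_total k L with hkL | hkL
    · rw [Nat.sub_eq_zero_of_le hkL]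
      simp only [not_lt_zero, filter_false, sum_empty, mul_zero]
      positivity
    refine (mul_le_mul_of_nonneg_left (sum_two_pow_filter_le K _) hd).trans ?_
    have e : (2 : ℝ) ^ k = 2 ^ (k - L) * 2 ^ L := by rw [← pow_add]; congr 1; omega
    have e2 : r * r ≤ r * 2 ^ L := mul_le_mul_of_nonneg_left hL hr
    rw [e, hdd]
    have e3 : (0 : ℝ) ≤ 2 ^ (k - L) := by positivity
    nlinarith [mul_le_mul_of_nonneg_left e2 e3]
  have f4 : ∀ k, (4 : ℝ) ^ k = 2 ^ k * 2 ^ k := fun k => by rw [← mul_pow]; norm_num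
  refine (abs_sum_le_sum_abs _ _).trans ((sum_le_sum fun k _ =>
    (abs_sum_le_sum_abs _ _).trans (sum_le_sum fun l _ => hpt k l)).trans ?_)
  simp only [sum_add_distrib]
  rw [sum_comm (f := fun k l => (C * r / 2) * (if l ≤ k + L ∧ k ≤ l + L then 4 ^ l * t l else 0)),
    sum_comm (f := fun k l => (C * 2 ^ l * t l) * (if k < l + L + 1 then 2 ^ k else 0)),
    sum_comm (f := fun k l => (d * 2 ^ l * t l) * (if k < l - L then 2 ^ k else 0))]
  simp only [← mul_sum]
  -- Per scale: `C r (2L + 1) / 2` from the square roots, `4 C r` from the linear terms and `r` from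
  -- distant scales.
  have main : ∀ {s : ℕ → ℝ}, (∀ k, 0 ≤ s k) →
      C * r / 2 * ∑ k ∈ range K, ∑ l ∈ range K, (if k ≤ l + L ∧ l ≤ k + L then 4 ^ k * s k else 0) +
      ∑ k ∈ range K, C * 2 ^ k * s k * ∑ l ∈ range K, (if l < k + L + 1 then (2 : ℝ) ^ l else 0) +
      ∑ k ∈ range K, d * 2 ^ k * s k * ∑ l ∈ range K, (if l < k - L then (2 : ℝ) ^ l else 0) ≤
      (C * (L + 5) + 1) * r * ∑ k ∈ range K, 4 ^ k * s k := by
    intro s hs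
    rw [mul_sum, mul_sum, ← sum_add_distrib, ← sum_add_distrib]
    refine sum_le_sum fun k _ => ?_
    have a0 : (0 : ℝ) ≤ 4 ^ k * s k := mul_nonneg (by positivity) (hs k)
    have a1 := mul_le_mul_of_nonneg_left (hnear k _ a0) (by positivity : 0 ≤ C * r / 2)
    have a2 := mul_le_mul_of_nonneg_left (hup k)
      (mul_nonneg (by positivity) (hs k) : 0 ≤ C * 2 ^ k * s k)
    have a3 := mul_le_mul_of_nonneg_left (hdown k)
      (mul_nonneg (by positivity) (hs k) : (0 : ℝ) ≤ 2 ^ k * s k)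
    have a4 : 0 ≤ C * r * (4 ^ k * s k) := by positivity
    rw [f4] at *
    nlinarith
  have m1 := main hs
  have m2 := main ht
  linarith

end ScaleSums

open Filter Topology

/-! ### Binary digits -/

section BinaryDigits

/-- The `k`-th binary digit of a natural number, as a real number. -/
noncomputable def digit (x k : ℕ) : ℝ := if x.testBit k then 1 else 0

lemma digit_nonneg (x k : ℕ) : 0 ≤ digit x k := by unfold digit; split_ifs <;> norm_num

lemma mod_two_pow_eq_sum_digit (x K : ℕ) :
    ((x % 2 ^ K : ℕ) : ℝ) = ∑ k ∈ range K, 2 ^ k * digit x k := by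
  induction K with
  | zero => simp [Nat.mod_one]
  | succ K ih =>
    have h1 : digit x K = ((x / 2 ^ K % 2 : ℕ) : ℝ) := by
      rw [digit, ← Nat.toNat_testBit]
      cases x.testBit K <;> simp
    rw [sum_range_succ, ← ih, h1, pow_succ, Nat.mod_mul]
    push_cast
    ring

/-- A digit equals its own square, so this compares a sum of squares with the square of a sum of
nonnegative terms. Thus the digit sets together weigh no more than the squared norm. -/
lemma sum_four_pow_digit_le (x K : ℕ) :
    ∑ k ∈ range K, 4 ^ k * digit x k ≤ ((x % 2 ^ K : ℕ) : ℝ) ^ 2 := by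
  rw [mod_two_pow_eq_sum_digit]
  induction K with
  | zero => simp
  | succ K ih =>
    rw [sum_range_succ, sum_range_succ]
    have h0 : 0 ≤ ∑ k ∈ range K, 2 ^ k * digit x k :=
      sum_nonneg fun k _ => mul_nonneg (by positivity) (digit_nonneg x k)
    have h1 : (4 : ℝ) ^ K = 2 ^ K * 2 ^ K := by rw [← mul_pow]; norm_num
    have h2 : digit x K * digit x K = digit x K := by unfold digit; split_ifs <;> norm_num
    have h3 : (0 : ℝ) ≤ 2 ^ K * digit x K := mul_nonneg (by positivity) (digit_nonneg x K)
    have h4 : (4 : ℝ) ^ K * digit x K = (2 ^ K * digit x K) * (2 ^ K * digit x K) := by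
      rw [h1]; linear_combination (-(2 : ℝ) ^ K * 2 ^ K) * h2
    rw [h4]
    nlinarith [mul_nonneg h0 h3]

end BinaryDigits

/-! ### The norm of the centered form -/

section Form

variable {V E : Type*} [Fintype E] {n : ℕ}

/-- The bilinear form of the matching edges over `E`, minus its expectation. -/
noncomputable def centeredForm (src tgt : E → V) (π : E → Equiv.Perm (Fin n)) :
    (Fin n × V → ℝ) →ₗ[ℝ] (Fin n × V → ℝ) →ₗ[ℝ] ℝ :=
  LinearMap.mk₂ ℝ (fun x y => ∑ e, (∑ i, x (i, src e) * y (π e i, tgt e) -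
      (∑ i, x (i, src e)) * (∑ i, y (i, tgt e)) / n))
    (fun x x' y => by
      rw [← sum_add_distrib]; refine sum_congr rfl fun e _ => ?_
      simp only [Pi.add_apply, add_mul, sum_add_distrib]; ring)
    (fun c x y => by
      rw [smul_eq_mul, mul_sum]; refine sum_congr rfl fun e _ => ?_
      simp only [Pi.smul_apply, smul_eq_mul, mul_assoc, ← mul_sum]; ring)
    (fun x y y' => by
      rw [← sum_add_distrib]; refine sum_congr rfl fun e _ => ?_
      simp only [Pi.add_apply, mul_add, sum_add_distrib]; ring)
    (fun c x y => by
      rw [smul_eq_mul, mul_sum]; refine sum_congr rfl fun e _ => ?_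
      simp only [Pi.smul_apply, smul_eq_mul, mul_left_comm _ c, ← mul_sum]; ring)

lemma centeredForm_apply (src tgt : E → V) (π : E → Equiv.Perm (Fin n)) (x y : Fin n × V → ℝ) :
    centeredForm src tgt π x y = ∑ e, (∑ i, x (i, src e) * y (π e i, tgt e) -
      (∑ i, x (i, src e)) * (∑ i, y (i, tgt e)) / n) := rfl

lemma centeredForm_indicator (src tgt : E → V) (π : E → Equiv.Perm (Fin n))
    (p q : Fin n × V → Prop) [DecidablePred p] [DecidablePred q] :
    centeredForm src tgt π (fun a => if p a then 1 else 0) (fun a => if q a then 1 else 0) =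
      ∑ e, crossings src tgt π (fun u => univ.filter fun i => p (i, u))
          (fun u => univ.filter fun i => q (i, u)) e -
      ∑ e, meanCrossings src tgt (fun u => univ.filter fun i : Fin n => p (i, u))
          (fun u => univ.filter fun i => q (i, u)) e := by
  rw [centeredForm_apply, ← sum_sub_distrib]
  refine sum_congr rfl fun e _ => ?_
  simp only [crossings, meanCrossings, card_filter, Nat.cast_sum, Nat.cast_ite, Nat.cast_one,
    Nat.cast_zero, filter_filter, mem_filter, mem_univ, true_and, ← ite_and, ite_mul, one_mul,
    zero_mul]

variable [Fintype V] {src tgt : E → V}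

/-- The norm bound on nonnegative vectors, by approximation. -/
lemma abs_centeredForm_le_of_nonneg {π : E → Equiv.Perm (Fin n)} {M : ℝ}
    (h : ∀ x y : Fin n × V → ℕ, |centeredForm src tgt π (fun a => x a) (fun a => y a)| ≤
      M * (∑ a, (x a : ℝ) ^ 2 + ∑ a, (y a : ℝ) ^ 2)) {x y : Fin n × V → ℝ} (hx : ∀ a, 0 ≤ x a)
    (hy : ∀ a, 0 ≤ y a) :
    |centeredForm src tgt π x y| ≤ M * (∑ a, x a ^ 2 + ∑ a, y a ^ 2) := by
  -- Both sides are homogeneous of degree two, so the bound for natural entries passes to entries in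
  -- `R⁻¹ ℕ`, which approximate `x` as `R` grows.
  let f : (Fin n × V → ℝ) → ℝ → Fin n × V → ℝ := fun x R a => (⌊x a * R⌋₊ : ℝ) / R
  have hf : ∀ x : Fin n × V → ℝ, (∀ a, 0 ≤ x a) → ∀ a, Tendsto (fun R => f x R a) atTop (𝓝 (x a)) :=
    fun x hx a => tendsto_nat_floor_mul_div_atTop (hx a)
  have h1 : Tendsto (fun R => |centeredForm src tgt π (f x R) (f y R)|) atTop
      (𝓝 |centeredForm src tgt π x y|) := by
    refine Tendsto.abs ?_
    simp only [centeredForm_apply]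
    refine tendsto_finsetSum _ fun e _ => Tendsto.sub ?_ ?_
    · exact tendsto_finsetSum _ fun i _ => (hf x hx _).mul (hf y hy _)
    · exact ((tendsto_finsetSum _ fun i _ => hf x hx _).mul
        (tendsto_finsetSum _ fun i _ => hf y hy _)).div_const _
  have h2 : Tendsto (fun R => M * (∑ a, f x R a ^ 2 + ∑ a, f y R a ^ 2)) atTop
      (𝓝 (M * (∑ a, x a ^ 2 + ∑ a, y a ^ 2))) :=
    ((tendsto_finsetSum _ fun a _ => (hf x hx a).pow 2).add
      (tendsto_finsetSum _ fun a _ => (hf y hy a).pow 2)).const_mul M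
  refine le_of_tendsto_of_tendsto h1 h2 ?_
  filter_upwards [eventually_gt_atTop 0] with R hR
  have e1 : ∀ x, f x R = R⁻¹ • fun a => ((⌊x a * R⌋₊ : ℕ) : ℝ) := by
    intro x; ext a; simp [f, div_eq_inv_mul]
  have h3 := h (fun a => ⌊x a * R⌋₊) (fun a => ⌊y a * R⌋₊)
  have e2 : ∀ x, ∑ a, f x R a ^ 2 = R⁻¹ * R⁻¹ * ∑ a, ((⌊x a * R⌋₊ : ℕ) : ℝ) ^ 2 := by
    intro x
    rw [mul_sum]
    refine sum_congr rfl fun a _ => ?_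
    rw [e1]; simp only [Pi.smul_apply, smul_eq_mul]; ring
  rw [e2, e2, e1, e1]
  simp only [map_smul, LinearMap.smul_apply, smul_eq_mul]
  rw [← mul_assoc, abs_mul, abs_of_nonneg (by positivity : 0 ≤ R⁻¹ * R⁻¹), ← mul_add, mul_left_comm]
  exact mul_le_mul_of_nonneg_left h3 (by positivity)

/-- Split `z` into positive and negative parts. Their squared norms add up to that of `z`, and each
occurs four times in the bounds for the four resulting terms. -/
lemma abs_centeredForm_self_le {π : E → Equiv.Perm (Fin n)} {M : ℝ}
    (h : ∀ x y : Fin n × V → ℕ, |centeredForm src tgt π (fun a => x a) (fun a => y a)| ≤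
      M * (∑ a, (x a : ℝ) ^ 2 + ∑ a, (y a : ℝ) ^ 2)) (z : Fin n × V → ℝ) :
    |centeredForm src tgt π z z| ≤ 4 * M * ∑ a, z a ^ 2 := by
  have hz : z = z⁺ - z⁻ := (posPart_sub_negPart z).symm
  have hp : ∀ a, 0 ≤ z⁺ a := fun a => posPart_nonneg z a
  have hm : ∀ a, 0 ≤ z⁻ a := fun a => negPart_nonneg z a
  have hsq : ∑ a, z a ^ 2 = ∑ a, z⁺ a ^ 2 + ∑ a, z⁻ a ^ 2 := by
    rw [← sum_add_distrib]
    refine sum_congr rfl fun a _ => ?_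
    rw [Pi.posPart_apply, Pi.negPart_apply]
    rcases le_total 0 (z a) with h0 | h0
    · rw [posPart_of_nonneg h0, negPart_of_nonneg h0]; ring
    · rw [posPart_of_nonpos h0, negPart_of_nonpos h0]; ring
  have h1 := abs_centeredForm_le_of_nonneg h hp hp
  have h2 := abs_centeredForm_le_of_nonneg h hp hm
  have h3 := abs_centeredForm_le_of_nonneg h hm hp
  have h4 := abs_centeredForm_le_of_nonneg h hm hm
  have e : centeredForm src tgt π z z = centeredForm src tgt π z⁺ z⁺ - centeredForm src tgt π z⁺ z⁻
      - centeredForm src tgt π z⁻ z⁺ + centeredForm src tgt π z⁻ z⁻ := by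
    conv_lhs => rw [hz]
    simp only [map_sub, LinearMap.sub_apply]
    ring
  rw [e, hsq]
  rw [abs_le] at *
  constructor <;> linarith [h1.1, h1.2, h2.1, h2.2, h3.1, h3.2, h4.1, h4.2]

variable [DecidableEq V]

/-- Over each edge both the count and its mean lie between `0` and the size of the source fibre. No
randomness is involved. -/
lemma abs_sum_crossings_sub_le_left {d : ℕ} (hn : 1 ≤ n) (π : E → Equiv.Perm (Fin n))
    (hsrc : ∀ u, (univ.filter fun e => src e = u).card ≤ d) (S T : V → Finset (Fin n)) :
    |∑ e, crossings src tgt π S T e - ∑ e, meanCrossings src tgt S T e| ≤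
      d * ∑ u, ((S u).card : ℝ) := by
  have hn0 : (0 : ℝ) < n := by exact_mod_cast hn
  refine le_trans ?_ (sum_comp_le_of_fiber_card_le hsrc (fun u => ((S u).card : ℝ))
    fun _ => Nat.cast_nonneg _)
  rw [← sum_sub_distrib]
  refine (abs_sum_le_sum_abs _ _).trans (sum_le_sum fun e _ => ?_)
  have h1 : crossings src tgt π S T e ≤ (S (src e)).card := by
    unfold crossings; exact_mod_cast card_filter_le _ _
  have h2 : meanCrossings src tgt S T e ≤ (S (src e)).card := by
    have : ((T (tgt e)).card : ℝ) ≤ n := by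
      exact_mod_cast (card_le_univ (T (tgt e))).trans_eq (Fintype.card_fin n)
    rw [meanCrossings, div_le_iff₀ hn0]
    exact mul_le_mul_of_nonneg_left this (Nat.cast_nonneg _)
  have h3 := crossings_nonneg src tgt π S T e
  have h4 := meanCrossings_nonneg src tgt S T e
  rw [abs_sub_le_iff]
  constructor <;> linarith

lemma abs_sum_crossings_sub_le_right {d : ℕ} (hn : 1 ≤ n) (π : E → Equiv.Perm (Fin n))
    (htgt : ∀ u, (univ.filter fun e => tgt e = u).card ≤ d) (S T : V → Finset (Fin n)) :
    |∑ e, crossings src tgt π S T e - ∑ e, meanCrossings src tgt S T e| ≤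
      d * ∑ u, ((T u).card : ℝ) := by
  have h1 : ∀ e, crossings src tgt π S T e =
      crossings tgt src (fun e => (π e).symm) T S e := by
    intro e
    rw [crossings, crossings, ← card_map (π e).toEmbedding]
    congr 2
    ext j
    simp only [mem_map_equiv, mem_filter, Equiv.apply_symm_apply, and_comm]
  have h2 : ∀ e, meanCrossings src tgt S T e = meanCrossings tgt src T S e := by
    intro e
    rw [meanCrossings, meanCrossings, mul_comm]
  simp only [h1, h2]
  exact abs_sum_crossings_sub_le_left hn _ htgt T S

/-- The norm bound on vectors with natural entries. -/
lemma IsConcentrated.abs_centeredForm_natCast_le {π : E → Equiv.Perm (Fin n)} {d L : ℕ}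
    (hn : 1 ≤ n) (hπ : IsConcentrated src tgt π)
    (hsrc : ∀ u, (univ.filter fun e => src e = u).card ≤ d)
    (htgt : ∀ u, (univ.filter fun e => tgt e = u).card ≤ d)
    (hL : √(d : ℝ) ≤ 2 ^ L) (hL' : 2 ^ L ≤ 2 * √(d : ℝ)) (x y : Fin n × V → ℕ) :
    |centeredForm src tgt π (fun a => x a) (fun a => y a)| ≤
      (140000 * (L + 5) + 1) * √(d : ℝ) * (∑ a, (x a : ℝ) ^ 2 + ∑ a, (y a : ℝ) ^ 2) := by
  obtain ⟨K, hx, hy⟩ : ∃ K, (∀ a, x a < 2 ^ K) ∧ ∀ a, y a < 2 ^ K := by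
    refine ⟨∑ a, x a + ∑ a, y a, fun a => ?_, fun a => ?_⟩
    · have h1 := single_le_sum (f := x) (fun _ _ => Nat.zero_le _) (mem_univ a)
      exact lt_of_le_of_lt (by omega) (Nat.lt_two_pow_self (n := ∑ a, x a + ∑ a, y a))
    · have h1 := single_le_sum (f := y) (fun _ _ => Nat.zero_le _) (mem_univ a)
      exact lt_of_le_of_lt (by omega) (Nat.lt_two_pow_self (n := ∑ a, x a + ∑ a, y a))
  let fib : (Fin n × V → ℕ) → ℕ → V → Finset (Fin n) := fun x k u =>
    univ.filter fun i => (x (i, u)).testBit k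
  have hexp : ∀ x : Fin n × V → ℕ, (∀ a, x a < 2 ^ K) →
      (fun a => (x a : ℝ)) = ∑ k ∈ range K, (2 : ℝ) ^ k • fun a => digit (x a) k := by
    intro x hx
    ext a
    have := mod_two_pow_eq_sum_digit (x a) K
    rw [Nat.mod_eq_of_lt (hx a)] at this
    rw [this, Finset.sum_apply]
    rfl
  have hsize : ∀ (x : Fin n × V → ℕ) (k : ℕ), ∑ u, ((fib x k u).card : ℝ) = ∑ a, digit (x a) k := by
    intro x k
    rw [Fintype.sum_prod_type_right]
    refine sum_congr rfl fun u _ => ?_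
    simp [fib, digit]
  have hnorm : ∀ x : Fin n × V → ℕ, (∀ a, x a < 2 ^ K) →
      ∑ k ∈ range K, 4 ^ k * ∑ u, ((fib x k u).card : ℝ) ≤ ∑ a, (x a : ℝ) ^ 2 := by
    intro x hx
    simp only [hsize, mul_sum]
    rw [sum_comm]
    refine sum_le_sum fun a _ => ?_
    have := sum_four_pow_digit_le (x a) K
    rwa [Nat.mod_eq_of_lt (hx a)] at this
  let D : ℕ → ℕ → ℝ := fun k l => ∑ e, crossings src tgt π (fib x k) (fib y l) e -
    ∑ e, meanCrossings src tgt (fib x k) (fib y l) e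
  have hD : centeredForm src tgt π (fun a => x a) (fun a => y a) =
      ∑ k ∈ range K, ∑ l ∈ range K, 2 ^ k * 2 ^ l * D k l := by
    rw [hexp x hx, hexp y hy]
    simp only [map_sum, map_smul, LinearMap.sum_apply, LinearMap.smul_apply, smul_eq_mul]
    simp only [mul_sum]
    rw [sum_comm]
    refine sum_congr rfl fun k _ => sum_congr rfl fun l _ => ?_
    have := centeredForm_indicator src tgt π (fun a => (x a).testBit k) (fun a => (y a).testBit l)
    rw [show D k l = centeredForm src tgt π (fun a => digit (x a) k) (fun a => digit (y a) l) from
      this.symm]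
    ring
  rw [hD]
  have hmain := abs_sum_scales_le (s := fun k => ∑ u, ((fib x k u).card : ℝ))
    (t := fun l => ∑ u, ((fib y l u).card : ℝ)) (D := D) (d := d) (C := 140000) (L := L) K
    (Nat.cast_nonneg d) (by norm_num) (fun k => sum_nonneg fun _ _ => Nat.cast_nonneg _)
    (fun k => sum_nonneg fun _ _ => Nat.cast_nonneg _) hL hL'
    (fun k l => abs_sum_crossings_sub_le_left hn π hsrc _ _)
    (fun k l => abs_sum_crossings_sub_le_right hn π htgt _ _)
    (fun k l => (hπ.isMixing hn hsrc htgt (fib x k) (fib y l)).discrepancy (Nat.cast_nonneg d))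
  refine hmain.trans (mul_le_mul_of_nonneg_left (add_le_add (hnorm x hx) (hnorm y hy)) ?_)
  positivity

end Form

/-! ### Eigenvalues and the quadratic form off the constants -/

section Spectral

variable {V : Type*} [Fintype V] (G : SimpleGraph V)

open Classical in
/-- The bilinear form of the adjacency matrix. -/
noncomputable def adjForm (f g : V → ℝ) : ℝ := ∑ a, ∑ b, if G.Adj a b then f a * g b else 0

lemma adjForm_comm (f g : V → ℝ) : adjForm G f g = adjForm G g f := by
  classical
  rw [adjForm, adjForm, sum_comm]
  refine sum_congr rfl fun a _ => sum_congr rfl fun b _ => ?_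
  rw [mul_comm (f b)]
  exact if_congr (G.adj_comm b a) rfl rfl

lemma adjForm_add_left (f f' g : V → ℝ) :
    adjForm G (f + f') g = adjForm G f g + adjForm G f' g := by
  simp only [adjForm, ← sum_add_distrib]
  refine sum_congr rfl fun a _ => sum_congr rfl fun b _ => ?_
  split_ifs <;> simp [add_mul]

lemma adjForm_smul_left (c : ℝ) (f g : V → ℝ) : adjForm G (c • f) g = c * adjForm G f g := by
  simp only [adjForm, mul_sum]
  refine sum_congr rfl fun a _ => sum_congr rfl fun b _ => ?_
  split_ifs <;> simp [mul_assoc]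

-- The spectral theorem in coordinates, reindexed so that the eigenvectors follow the decreasing
-- order of `adjEigenvalues`.
open Classical in
lemma exists_eigenbasis : ∃ v : Fin (Fintype.card V) → V → ℝ,
    (∀ k g, adjForm G g (v k) = adjEigenvalues G k * ∑ a, g a * v k a) ∧
    (∀ k l, ∑ a, v k a * v l a = if k = l then 1 else 0) ∧
    ∀ (f : V → ℝ) (a : V), f a = ∑ k, (∑ b, v k b * f b) * v k a := by
  have hA : (G.adjMatrix ℝ).IsHermitian := by
    rw [Matrix.IsHermitian, Matrix.conjTranspose_eq_transpose_of_trivial]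
    exact G.isSymm_adjMatrix
  let eqv : Fin (Fintype.card V) ≃ V := Fintype.equivOfCardEq (Fintype.card_fin _)
  have hin : ∀ x y : EuclideanSpace ℝ V, inner ℝ x y = ∑ a, x a * y a := by
    intro x y
    rw [PiLp.inner_apply]
    exact sum_congr rfl fun a _ => by rw [RCLike.inner_apply, conj_trivial, mul_comm]
  refine ⟨fun k a => hA.eigenvectorBasis (eqv k) a, fun k g => ?_, fun k l => ?_, fun f a => ?_⟩
  · have h1 := hA.mulVec_eigenvectorBasis (eqv k)
    have h2 : hA.eigenvalues (eqv k) = adjEigenvalues G k := by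
      rw [Matrix.IsHermitian.eigenvalues, Equiv.symm_apply_apply]
      rfl
    rw [h2] at h1
    rw [adjForm, mul_sum]
    refine sum_congr rfl fun a _ => ?_
    have h3 := congrFun h1 a
    rw [SimpleGraph.adjMatrix_mulVec_apply, Pi.smul_apply, smul_eq_mul] at h3
    rw [mul_left_comm, ← h3, ← sum_filter, ← mul_sum]
    congr 2
    ext b
    simp
  · have := orthonormal_iff_ite.1 hA.eigenvectorBasis.orthonormal (eqv k) (eqv l)
    rw [hin] at this
    simp only [this, eqv.injective.eq_iff]
  · have := hA.eigenvectorBasis.sum_repr' (WithLp.toLp 2 f)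
    have h2 := congrArg (fun x : EuclideanSpace ℝ V => x a) this
    simp only [hin] at h2
    rw [← eqv.sum_comp] at h2
    simpa using h2.symm

variable {G}

/-- The quadratic form on the vectors orthogonal to the constants, from the eigenvalues. -/
lemma abs_adjForm_le_of_eigenvalues {d b : ℝ} (hb : b < d)
    (hd : ∀ g, adjForm G (fun _ => 1) g = d * ∑ a, g a)
    (h : NontrivialEigenvaluesBoundedBy G b) {f : V → ℝ} (hf : ∑ a, f a = 0) :
    |adjForm G f f| ≤ b * ∑ a, f a ^ 2 := by
  classical
  obtain ⟨v, hv, ho, hs⟩ := exists_eigenbasis G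
  set c : Fin (Fintype.card V) → ℝ := fun k => ∑ b, v k b * f b with hc
  -- The constants have eigenvalue `d > b`, so they are orthogonal to every eigenvector of index
  -- other than `0`. They are thus spanned by the one of index `0`, to which `f` is then orthogonal.
  have h0 : ∀ k : Fin (Fintype.card V), (k : ℕ) ≠ 0 → ∑ a, v k a = 0 := by
    intro k hk
    have h1 := hv k fun _ => 1
    rw [hd] at h1
    simp only [one_mul] at h1
    have h2 : (d - adjEigenvalues G k) * ∑ a, v k a = 0 := by linarith
    have h3 := abs_le.1 (h k hk)
    exact (mul_eq_zero.1 h2).resolve_left (by linarith)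
  have hc0 : ∀ k : Fin (Fintype.card V), (k : ℕ) = 0 → c k = 0 := by
    intro k hk
    have hone : ∀ a, 1 = (∑ b, v k b) * v k a := by
      intro a
      have := hs (fun _ => 1) a
      rw [sum_eq_single k] at this
      · simpa using this
      · intro l _ hl
        have : (l : ℕ) ≠ 0 := fun h => hl (Fin.ext (h.trans hk.symm))
        simp [h0 l this]
      · simp
    have h1 : 0 = (∑ b, v k b) * c k := by
      rw [← hf, hc, mul_sum]
      refine sum_congr rfl fun a _ => ?_
      rw [← mul_assoc, ← hone a, one_mul]
    have hne : (∑ b, v k b) ≠ 0 := by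
      have hcard : 0 < Fintype.card V := lt_of_le_of_lt (Nat.zero_le _) k.2
      obtain ⟨a⟩ := Fintype.card_pos_iff.1 hcard
      intro hz
      have := hone a
      rw [hz, zero_mul] at this
      exact one_ne_zero this
    exact (mul_eq_zero.1 h1.symm).resolve_left hne
  have hsq : ∑ a, f a ^ 2 = ∑ k, c k ^ 2 := by
    have : ∀ a, f a ^ 2 = ∑ k, c k * (v k a * f a) := by
      intro a
      rw [sq]
      nth_rewrite 1 [hs f a]
      rw [sum_mul]
      exact sum_congr rfl fun k _ => by rw [mul_assoc]
    rw [sum_congr rfl fun a _ => this a, sum_comm]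
    refine sum_congr rfl fun k _ => ?_
    rw [← mul_sum, sq]
  have hq : adjForm G f f = ∑ k, adjEigenvalues G k * c k ^ 2 := by
    have h1 : f = fun a => ∑ k, c k * v k a := funext (hs f)
    have h2 : adjForm G f f = ∑ k, c k * adjForm G f (v k) := by
      have h3 : ∀ a b, (if G.Adj a b then f a * f b else 0) =
          ∑ k, c k * (if G.Adj a b then f a * v k b else 0) := by
        intro a b
        split_ifs
        · nth_rewrite 2 [h1]
          rw [mul_sum]
          exact sum_congr rfl fun k _ => by ring
        · simp
      simp only [adjForm, h3, mul_sum]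
      rw [sum_congr rfl fun a _ => sum_comm, sum_comm]
    rw [h2]
    refine sum_congr rfl fun k _ => ?_
    rw [hv, hc]
    simp only [mul_comm (f _)]
    ring
  rw [hq, hsq, mul_sum]
  refine (abs_sum_le_sum_abs _ _).trans (sum_le_sum fun k _ => ?_)
  rw [abs_mul, abs_of_nonneg (sq_nonneg (c k))]
  by_cases hk : (k : ℕ) = 0
  · rw [hc0 k hk]; simp
  · exact mul_le_mul_of_nonneg_right (h k hk) (sq_nonneg _)

/-- The bound on the eigenvalues, from the quadratic form on the vectors orthogonal to the
constants. -/
lemma nontrivialEigenvaluesBoundedBy_of_adjForm {d b : ℝ} (hd0 : 0 ≤ d)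
    (hd : ∀ g, adjForm G (fun _ => 1) g = d * ∑ a, g a)
    (h : ∀ f : V → ℝ, ∑ a, f a = 0 → |adjForm G f f| ≤ b * ∑ a, f a ^ 2) :
    NontrivialEigenvaluesBoundedBy G b := by
  classical
  intro i hi
  obtain ⟨v, hv, ho, -⟩ := exists_eigenbasis G
  have hnorm : ∀ k, ∑ a, v k a ^ 2 = 1 := fun k => by
    have := ho k k
    simpa [sq] using this
  have hq : ∀ k, adjForm G (v k) (v k) = adjEigenvalues G k := fun k => by
    rw [hv, ho]; simp
  have hsum : ∀ k, ∑ a, v k a = 0 → |adjEigenvalues G k| ≤ b := by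
    intro k hk
    have := h (v k) hk
    rwa [hq, hnorm, mul_one] at this
  -- The lift may be disconnected, so `d` may be a multiple eigenvalue and `v i` need not be
  -- orthogonal to the constants. If it is not, its eigenvalue is `d`; a combination of `v i` and
  -- the top eigenvector that is orthogonal to the constants has Rayleigh quotient at least that
  -- eigenvalue.
  by_cases hz : ∑ a, v i a = 0
  · exact hsum i hz
  have hid : adjEigenvalues G i = d := by
    have h1 := hv i fun _ => 1
    rw [hd] at h1
    simp only [one_mul] at h1
    exact (mul_right_cancel₀ hz h1).symm
  rw [hid, abs_of_nonneg hd0, ← hid]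
  let z : Fin (Fintype.card V) := ⟨0, lt_of_le_of_lt (Nat.zero_le _) i.2⟩
  have hzi : z ≠ i := fun h => hi (by rw [← h])
  have hle : adjEigenvalues G i ≤ adjEigenvalues G z :=
    Matrix.IsHermitian.eigenvalues₀_antitone _ (Fin.le_def.2 (Nat.zero_le _))
  set α := ∑ a, v z a
  set β := ∑ a, v i a
  have hf := h (α • v i + (-β) • v z) (by
    simp only [Pi.add_apply, Pi.smul_apply, smul_eq_mul, sum_add_distrib, ← mul_sum]
    ring)
  have hzi0 : adjForm G (v z) (v i) = 0 := by rw [hv, ho, if_neg hzi, mul_zero]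
  have hiz0 : adjForm G (v i) (v z) = 0 := by rw [hv, ho, if_neg hzi.symm, mul_zero]
  have e1 : adjForm G (α • v i + (-β) • v z) (α • v i + (-β) • v z) =
      α ^ 2 * adjEigenvalues G i + β ^ 2 * adjEigenvalues G z := by
    rw [adjForm_add_left, adjForm_smul_left, adjForm_smul_left, adjForm_comm, adjForm_comm G (v z),
      adjForm_add_left, adjForm_add_left, adjForm_smul_left, adjForm_smul_left, adjForm_smul_left,
      adjForm_smul_left, hzi0, hiz0, hq, hq]
    ring
  have e2 : ∑ a, (α • v i + (-β) • v z) a ^ 2 = α ^ 2 + β ^ 2 := by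
    have : ∀ a, (α • v i + (-β) • v z) a ^ 2 =
        α ^ 2 * v i a ^ 2 + β ^ 2 * v z a ^ 2 - 2 * α * β * (v i a * v z a) := by
      intro a
      simp only [Pi.add_apply, Pi.smul_apply, smul_eq_mul]
      ring
    simp only [this, sum_sub_distrib, sum_add_distrib, ← mul_sum, hnorm, ho, if_neg hzi.symm]
    ring
  rw [e1, e2] at hf
  have hβ : 0 < β ^ 2 := by positivity
  have h3 := (abs_le.1 hf).2
  have h4 : adjEigenvalues G i * (α ^ 2 + β ^ 2) ≤ b * (α ^ 2 + β ^ 2) := by nlinarith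
  exact le_of_mul_le_mul_right h4 (by positivity)

open Classical in
lemma adjForm_one_left {d : ℕ} (hG : G.IsRegularOfDegree d) (g : V → ℝ) :
    adjForm G (fun _ => 1) g = d * ∑ a, g a := by
  rw [adjForm_comm, adjForm, mul_sum]
  refine sum_congr rfl fun a _ => ?_
  rw [← sum_filter, sum_const, nsmul_eq_mul, mul_one, ← hG a, ← SimpleGraph.card_neighborFinset_eq_degree]
  have : univ.filter (fun b => G.Adj a b) = G.neighborFinset a := by ext b; simp
  rw [this]

end Spectral

/-! ### The adjacency form of a lift -/

section Lift

variable {V : Type*} [Fintype V] [LinearOrder V] {G : SimpleGraph V} {n : ℕ}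

noncomputable instance : Fintype (OrientedEdge G) := Fintype.ofFinite _

lemma adjForm_eq_sum_orientedEdge (f g : V → ℝ) :
    adjForm G f g = ∑ e : OrientedEdge G, (f e.1.1 * g e.1.2 + f e.1.2 * g e.1.1) := by
  classical
  have key : ∀ F : V → V → ℝ, ∑ u, ∑ v, (if G.Adj u v ∧ u < v then F u v else 0) =
      ∑ e : OrientedEdge G, F e.1.1 e.1.2 := by
    intro F
    rw [← Fintype.sum_prod_type' (f := fun u v => if G.Adj u v ∧ u < v then F u v else 0),
      ← sum_filter]
    exact sum_subtype _ (fun x => by simp) fun e : V × V => F e.1 e.2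
  rw [sum_add_distrib, ← key fun u v => f u * g v, ← key fun u v => f v * g u,
    sum_comm (f := fun u v => if G.Adj u v ∧ u < v then f v * g u else 0), ← sum_add_distrib,
    adjForm]
  refine sum_congr rfl fun u _ => ?_
  rw [← sum_add_distrib]
  refine sum_congr rfl fun v _ => ?_
  by_cases h : G.Adj u v
  · rcases lt_or_gt_of_ne h.ne with h1 | h1
    · simp [h, h1, not_lt.2 h1.le]
    · simp [h, h.symm, h1, not_lt.2 h1.le]
  · have h' : ¬ G.Adj v u := fun h' => h h'.symm
    simp [h, h']

lemma adjForm_lift (π : LiftData G n) (f g : Fin n × V → ℝ) :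
    adjForm (lift π) f g = ∑ e : OrientedEdge G, ∑ i,
      (f (i, e.1.1) * g (π e i, e.1.2) + f (π e i, e.1.2) * g (i, e.1.1)) := by
  classical
  let m : Fin n × V → Fin n × V → Prop := fun x y =>
    ∃ h : G.Adj x.2 y.2 ∧ x.2 < y.2, π ⟨(x.2, y.2), h⟩ x.1 = y.1
  have key : ∀ F : Fin n × V → Fin n × V → ℝ, ∑ x, ∑ y, (if m x y then F x y else 0) =
      ∑ e : OrientedEdge G, ∑ i, F (i, e.1.1) (π e i, e.1.2) := by
    intro F
    rw [← Fintype.sum_prod_type' (f := fun x y => if m x y then F x y else 0), ← sum_filter,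
      ← Fintype.sum_prod_type' (f := fun (e : OrientedEdge G) i => F (i, e.1.1) (π e i, e.1.2))]
    symm
    refine sum_bij (fun p _ => ((p.2, p.1.1.1), (π p.1 p.2, p.1.1.2))) ?_ ?_ ?_ ?_
    · rintro ⟨e, i⟩ _
      exact mem_filter.2 ⟨mem_univ _, e.2, rfl⟩
    · rintro ⟨⟨⟨u, v⟩, h⟩, i⟩ _ ⟨⟨⟨u', v'⟩, h'⟩, i'⟩ _ heq
      simp only [Prod.mk.injEq] at heq
      obtain ⟨⟨rfl, rfl⟩, -, rfl⟩ := heq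
      rfl
    · rintro ⟨⟨i, u⟩, ⟨j, v⟩⟩ hp
      obtain ⟨h, hπ⟩ := (mem_filter.1 hp).2
      refine ⟨(⟨(u, v), h⟩, i), mem_univ _, ?_⟩
      simp only at hπ ⊢
      rw [hπ]
    · intro _ _; rfl
  simp only [sum_add_distrib]
  rw [← key fun x y => f x * g y, ← key fun x y => f y * g x,
    sum_comm (f := fun x y => if m x y then f y * g x else 0), ← sum_add_distrib, adjForm]
  refine sum_congr rfl fun x _ => ?_
  rw [← sum_add_distrib]
  refine sum_congr rfl fun y _ => ?_
  have hadj : (lift π).Adj x y ↔ m x y ∨ m y x := Iff.rfl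
  have hdisj : ¬ (m x y ∧ m y x) := fun ⟨⟨h1, _⟩, ⟨h2, _⟩⟩ => lt_asymm h1.2 h2.2
  by_cases h1 : m x y <;> by_cases h2 : m y x
  · exact absurd ⟨h1, h2⟩ hdisj
  all_goals simp [hadj, h1, h2]

open Classical in
lemma adjForm_lift_one_left {d : ℕ} (hG : G.IsRegularOfDegree d) (π : LiftData G n)
    (g : Fin n × V → ℝ) : adjForm (lift π) (fun _ => 1) g = d * ∑ a, g a := by
  have h1 := adjForm_one_left hG fun u => ∑ i, g (i, u)
  rw [← Fintype.sum_prod_type_right] at h1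
  rw [← h1, adjForm_lift, adjForm_eq_sum_orientedEdge]
  refine sum_congr rfl fun e _ => ?_
  simp only [one_mul, sum_add_distrib]
  rw [Equiv.sum_comp (π e) fun j => g (j, e.1.2)]

open Classical in
lemma card_src_le {d : ℕ} (hG : G.IsRegularOfDegree d) (u : V) :
    (univ.filter fun e : OrientedEdge G => e.1.1 = u).card ≤ d := by
  rw [← hG u, ← SimpleGraph.card_neighborFinset_eq_degree]
  refine card_le_card_of_injOn (fun e => e.1.2) ?_ ?_
  · intro e he
    have he' : e.1.1 = u := (mem_filter.1 he).2
    have := e.2.1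
    rw [he'] at this
    simpa using this
  · rintro e he e' he' heq
    have h1 : e.1.1 = u := by simpa using he
    have h2 : e'.1.1 = u := by simpa using he'
    exact Subtype.ext (Prod.ext (h1.trans h2.symm) heq)

open Classical in
lemma card_tgt_le {d : ℕ} (hG : G.IsRegularOfDegree d) (u : V) :
    (univ.filter fun e : OrientedEdge G => e.1.2 = u).card ≤ d := by
  rw [← hG u, ← SimpleGraph.card_neighborFinset_eq_degree]
  refine card_le_card_of_injOn (fun e => e.1.1) ?_ ?_
  · intro e he
    have he' : e.1.2 = u := (mem_filter.1 he).2
    have := e.2.1.symm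
    rw [he'] at this
    simpa using this
  · rintro e he e' he' heq
    have h1 : e.1.2 = u := by simpa using he
    have h2 : e'.1.2 = u := by simpa using he'
    exact Subtype.ext (Prod.ext heq (h1.trans h2.symm))

/-- The mean subtracted in the centered form replaces each random matching by the complete bipartite
graph with weights `1 / n`, which sees only the fibre sums. -/
lemma adjForm_lift_self (hn : 1 ≤ n) (π : LiftData G n) (f : Fin n × V → ℝ) :
    adjForm (lift π) f f =
      2 * centeredForm (fun e : OrientedEdge G => e.1.1) (fun e => e.1.2) π f f +
        adjForm G (fun u => ∑ i, f (i, u)) (fun u => ∑ i, f (i, u)) / n := by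
  have hn0 : (n : ℝ) ≠ 0 := by positivity
  rw [adjForm_lift, adjForm_eq_sum_orientedEdge, centeredForm_apply, mul_sum, sum_div,
    ← sum_add_distrib]
  refine sum_congr rfl fun e _ => ?_
  rw [sum_add_distrib]
  simp only [mul_comm (f (π e _, e.1.2))]
  field_simp
  ring

end Lift

/-! ### Conclusion -/

/-- A scale `2 ^ L` comparable to the square root of `d`. -/
lemma exists_two_pow_near_sqrt {d : ℕ} (hd : 3 ≤ d) : ∃ L : ℕ, √(d : ℝ) ≤ 2 ^ L ∧
    2 ^ L ≤ 2 * √(d : ℝ) ∧ (L : ℝ) ≤ 1 + Real.logb 2 d / 2 := by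
  have hd0 : (0 : ℝ) < d := by positivity
  have f4 : ∀ k, (4 : ℝ) ^ k = (2 ^ k) ^ 2 := fun k => by rw [← pow_mul, mul_comm, pow_mul]; norm_num
  have h1 : (d : ℝ) ≤ 4 ^ Nat.clog 4 d := by exact_mod_cast Nat.le_pow_clog (by norm_num) d
  have h2 : (4 : ℝ) ^ Nat.clog 4 d ≤ 4 * d := by
    have h := Nat.pow_pred_clog_lt_self (b := 4) (by norm_num) (x := d) (by omega)
    have hpos : 0 < Nat.clog 4 d := Nat.clog_pos (by norm_num) (by omega)
    have h' : (4 : ℝ) ^ (Nat.clog 4 d - 1) ≤ d := by exact_mod_cast h.le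
    have e : (4 : ℝ) ^ Nat.clog 4 d = 4 * 4 ^ (Nat.clog 4 d - 1) := by
      rw [← pow_succ']; congr 1; omega
    rw [e]; linarith
  refine ⟨Nat.clog 4 d, ?_, ?_, ?_⟩
  · rw [f4] at h1
    exact Real.sqrt_le_iff.2 ⟨by positivity, h1⟩
  · refine (pow_le_pow_iff_left₀ (by positivity) (by positivity) two_ne_zero).1 ?_
    rw [← f4, mul_pow, Real.sq_sqrt hd0.le]
    linarith
  · have h3 := Real.logb_le_logb_of_le (b := 2) (by norm_num) (by positivity) h2
    rw [Real.logb_mul (by norm_num) hd0.ne', Real.logb_pow,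
      show (4 : ℝ) = 2 ^ (2 : ℕ) by norm_num, Real.logb_pow, Real.logb_self_eq_one (by norm_num)] at h3
    push_cast at h3
    linarith

open Classical in
/-- A concentrated lift of a Ramanujan graph has small nontrivial eigenvalues. -/
lemma IsConcentrated.nontrivialEigenvaluesBoundedBy {V : Type*} [Fintype V] [LinearOrder V]
    {G : SimpleGraph V} {d n : ℕ} (hd : 3 ≤ d) (hG : IsRamanujan G d) (hn : 1 ≤ n)
    {π : LiftData G n}
    (hπ : IsConcentrated (fun e : OrientedEdge G => e.1.1) (fun e => e.1.2) π) :
    NontrivialEigenvaluesBoundedBy (lift π) (10000000 * √(d : ℝ) * Real.logb 2 d) := by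
  obtain ⟨hreg, hram⟩ := hG
  have hd3 : (3 : ℝ) ≤ d := by exact_mod_cast hd
  have hn0 : (0 : ℝ) < n := by exact_mod_cast hn
  have hlog : 1 ≤ Real.logb 2 d := by
    rw [Real.le_logb_iff_rpow_le (by norm_num) (by linarith)]
    norm_num; linarith
  have hr : 0 ≤ √(d : ℝ) := Real.sqrt_nonneg _
  obtain ⟨L, hL, hL', hL''⟩ := exists_two_pow_near_sqrt hd
  -- Equivalent to `(d - 2)² > 0`; it separates the trivial eigenvalue of `G` from the others.
  have hlt : 2 * √((d : ℝ) - 1) < d := by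
    have : √((d : ℝ) - 1) < d / 2 := by
      rw [Real.sqrt_lt' (by linarith)]
      nlinarith
    linarith
  refine nontrivialEigenvaluesBoundedBy_of_adjForm (d := d) (by linarith)
    (adjForm_lift_one_left hreg π) fun f hf => ?_
  set g : V → ℝ := fun u => ∑ i, f (i, u)
  have hg : ∑ u, g u = 0 := by rw [← hf, Fintype.sum_prod_type_right]
  have h1 := abs_adjForm_le_of_eigenvalues hlt (adjForm_one_left hreg) hram hg
  have h2 := abs_centeredForm_self_le (fun x y => hπ.abs_centeredForm_natCast_le hn
    (card_src_le hreg) (card_tgt_le hreg) hL hL' x y) f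
  have h3 : ∑ u, g u ^ 2 ≤ n * ∑ a, f a ^ 2 := by
    rw [Fintype.sum_prod_type_right, mul_sum]
    refine sum_le_sum fun u _ => ?_
    have := sq_sum_le_card_mul_sum_sq (s := (univ : Finset (Fin n))) (f := fun i => f (i, u))
    rwa [card_univ, Fintype.card_fin] at this
  have h4 : √((d : ℝ) - 1) ≤ √(d : ℝ) := Real.sqrt_le_sqrt (by linarith)
  have hF : 0 ≤ ∑ a, f a ^ 2 := sum_nonneg fun _ _ => sq_nonneg _
  have h5 : |adjForm G g g / n| ≤ 2 * √(d : ℝ) * ∑ a, f a ^ 2 := by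
    rw [abs_div, abs_of_pos hn0, div_le_iff₀ hn0]
    refine h1.trans ?_
    calc 2 * √((d : ℝ) - 1) * ∑ u, g u ^ 2 ≤ 2 * √(d : ℝ) * (n * ∑ a, f a ^ 2) := by gcongr
      _ = _ := by ring
  rw [adjForm_lift_self hn]
  refine (abs_add_le _ _).trans ?_
  rw [abs_mul, abs_two]
  -- From `L ≤ 1 + log₂ d / 2` and `log₂ d ≥ 1`: `840001 + 70000 = 910001`. The factor `2 * 4` and
  -- the part from `G` then stay below `10000000`.
  have h6 : (140000 * ((L : ℝ) + 5) + 1) * √(d : ℝ) ≤ 910001 * (√(d : ℝ) * Real.logb 2 d) := by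
    have : 140000 * ((L : ℝ) + 5) + 1 ≤ 910001 * Real.logb 2 d := by linarith
    nlinarith
  have h7 : √(d : ℝ) ≤ √(d : ℝ) * Real.logb 2 d := le_mul_of_one_le_right hr hlog
  have h8 := mul_le_mul_of_nonneg_right h6 hF
  have h9 := mul_le_mul_of_nonneg_right h7 hF
  have h10 := mul_nonneg (mul_nonneg hr (zero_le_one.trans hlog)) hF
  linarith

end RandomLift

theorem corollary2 :
    ∃ C : ℝ, 0 < C ∧
      ∀ (V : Type*) [Fintype V] [LinearOrder V] (d : ℕ) (G : SimpleGraph V),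
        3 ≤ d → RandomLift.IsRamanujan G d →
          ∃ K : ℝ, ∀ n : ℕ, 1 ≤ n →
            1 - K / (n : ℝ) ^ 100 ≤
              RandomLift.liftProb G n (fun H =>
                RandomLift.NontrivialEigenvaluesBoundedBy H (C * √(d : ℝ) * Real.logb 2 (d : ℝ))) := by
  classical
  refine ⟨10000000, by norm_num, fun V _ _ d G hd hG => ⟨3 * 4 ^ Fintype.card V, fun n hn => ?_⟩⟩
  set P : SimpleGraph (Fin n × V) → Prop := fun H =>
    RandomLift.NontrivialEigenvaluesBoundedBy H (10000000 * √(d : ℝ) * Real.logb 2 (d : ℝ))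
  let src : RandomLift.OrientedEdge G → V := fun e => e.1.1
  let tgt : RandomLift.OrientedEdge G → V := fun e => e.1.2
  have hbad : ((Finset.univ.filter fun π : RandomLift.LiftData G n =>
      ¬ RandomLift.IsConcentrated src tgt π).card : ℝ) ≤
      3 * 4 ^ Fintype.card V / (n : ℝ) ^ 100 * (Fintype.card (RandomLift.LiftData G n) : ℝ) := by
    convert RandomLift.card_not_isConcentrated_le src tgt hn
  have hpos : (0 : ℝ) < Fintype.card (RandomLift.LiftData G n) := by
    exact_mod_cast Fintype.card_pos
  have hcard : (Fintype.card (RandomLift.LiftData G n) : ℝ) ≤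
      Nat.card {π : RandomLift.LiftData G n // P (RandomLift.lift π)} +
        ((Finset.univ.filter fun π : RandomLift.LiftData G n =>
          ¬ RandomLift.IsConcentrated src tgt π).card : ℝ) := by
    rw [Nat.card_eq_fintype_card, Fintype.card_subtype, ← Finset.card_univ,
      ← Finset.card_filter_add_card_filter_not (s := Finset.univ)
        (p := fun π : RandomLift.LiftData G n => RandomLift.IsConcentrated src tgt π)]
    push_cast
    gcongr with π
    exact fun hπ => hπ.nontrivialEigenvaluesBoundedBy hd hG hn
  rw [RandomLift.liftProb, Nat.card_eq_fintype_card (α := RandomLift.LiftData G n),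
    le_div_iff₀ hpos, sub_mul, one_mul]
  linarith
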